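/- Work over $\mathbb C$. A polynomial in $x_1,\dots,x_m;y_1,\dots,y_n$ is supersymmetric if it is symmetric in the $x_i$ and in the $y_j$ separately and if, for all $i,j$, the result of the substitution $x_i=-y_j=t$ does not depend on $t$. Let $\Lambda$ be the algebra of supersymmetric functions, that is, of the families of supersymmetric polynomials $F(x_1,\dots,x_m;y_1,\dots,y_n)$, $m,n\ge 0$, of bounded degree that are compatible with the specializations $x_m=0$ and $y_n=0$. Let $\mathbf p_k(x;y)=\sum_i x_i^k+(-1)^{k-1}\sum_j y_j^k\in\Lambda$, and define $h_k\in\Lambda$ by $1+\sum_{k\ge1}h_kt^k=\exp\bigl(\sum_{k\ge1}\mathbf p_kt^k/k\bigr)$ and $H(u)=1+\sum_{k\ge1}h_k/u^k$. Write $a^{\downarrow k}=a(a-1)\cdots(a-k+1)$. Let $\Lambda^*$ be the algebra of shifted symmetric functions, that is, of the families of polynomials $f(x_1,\dots,x_n)$, $n\ge 0$, of bounded degree, symmetric in the variables $x_j-j$ and compatible with the specializations $x_n=0$. For a Young diagram $\mu$ the shifted Schur function $s^*_\mu$ is the unique element of $\Lambda^*$ with $$s^*_\mu(x_1,\dots,x_n)=\frac{\det\bigl[(x_i+n-i)^{\downarrow(\mu_j+n-j)}\bigr]_{i,j=1}^n}{\det\bigl[(x_i+n-i)^{\downarrow(n-j)}\bigr]_{i,j=1}^n}$$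 for every $n$ not smaller than the number of rows of $\mu$. Put $h^*_k=s^*_{(k)}$ and $H^*(u)=1+\sum_{k\ge1}h^*_k/u^{\downarrow k}$. There is a unique algebra homomorphism $\varphi:\Lambda^*\to\Lambda$ with $\varphi(H^*(u))=H(u+\tfrac12)$, as formal series in $1/u$. The Frobenius–Schur function is $Fs_\mu=\varphi(s^*_\mu)\in\Lambda$. For Young diagrams $\mu,\nu$ let $\dim(\mu,\nu)$ be the number of chains of diagrams $\mu=\lambda^0\subset\lambda^1\subset\dots\subset\lambda^k=\nu$ with $k=|\nu|-|\mu|$ and strict inclusions if $\mu\subseteq\nu$, and $0$ otherwise; let $\dim\nu=\dim(\varnothing,\nu)$. In Frobenius notation $\nu=(p_1,\dots,p_d\,|\,q_1,\dots,q_d)$, where $d$ is the number of diagonal squares of $\nu$, $p_i=\nu_i-i$, $q_i=\nu'_i-i$, and $\nu'$ is the transposed diagram. **Theorem 2.1.** Let $\mu$ be a Young diagram and $m=|\mu|$. Then $Fs_\mu$ is the only supersymmetric function such that, for every Young diagram $\nu=(p_1,\dots,p_d\,|\,q_1,\dots,q_d)$ with $n=|\nu|\ge m$, $$\frac{\dim(\mu,\nu)}{\dim\nu}=\frac{Fs_\mu(p_1+\tfrac12,\dots,p_d+\tfrac12;\,q_1+\tfrac12,\dots,q_d+\tfrac12)}{n(n-1)\cdots(n-m+1)}.$$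 If $n<m$, so that the denominator on the right is $0$, then $\dim(\mu,\nu)=0$ and $Fs_\mu(p_1+\tfrac12,\dots,p_d+\tfrac12;\,q_1+\tfrac12,\dots,q_d+\tfrac12)=0$ as well. -/

import Mathlib

noncomputable section

namespace FrobeniusSchur

open MvPolynomial

/-! ### Supersymmetric functions -/

/-- The specialization `x_{m+1} = 0`, from polynomials in `x_1, …, x_{m+1}; y_1, …, y_n` to
polynomials in `x_1, …, x_m; y_1, …, y_n`. -/
def specX (m n : ℕ) : MvPolynomial (Fin (m + 1) ⊕ Fin n) ℂ →ₐ[ℂ] MvPolynomial (Fin m ⊕ Fin n) ℂ :=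
  aeval (Sum.elim (Fin.snoc (α := fun _ => MvPolynomial (Fin m ⊕ Fin n) ℂ)
    (fun i => X (Sum.inl i)) 0) (fun j => X (Sum.inr j)))

/-- The specialization `y_{n+1} = 0`, from polynomials in `x_1, …, x_m; y_1, …, y_{n+1}` to
polynomials in `x_1, …, x_m; y_1, …, y_n`. -/
def specY (m n : ℕ) : MvPolynomial (Fin m ⊕ Fin (n + 1)) ℂ →ₐ[ℂ] MvPolynomial (Fin m ⊕ Fin n) ℂ :=
  aeval (Sum.elim (fun i => X (Sum.inl i)) (Fin.snoc (α := fun _ => MvPolynomial (Fin m ⊕ Fin n) ℂ)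
    (fun j => X (Sum.inr j)) 0))

/-- The specialization `x_i = t`, `y_j = -t`; the other variables are left untouched. -/
def cancelSpec {m n : ℕ} (i : Fin m) (j : Fin n) (t : ℂ) :
    MvPolynomial (Fin m ⊕ Fin n) ℂ →ₐ[ℂ] MvPolynomial (Fin m ⊕ Fin n) ℂ :=
  aeval (Sum.elim (Function.update (fun k => X (Sum.inl k)) i (C t))
    (Function.update (fun k => X (Sum.inr k)) j (C (-t))))

/-- A polynomial in `x_1, …, x_m; y_1, …, y_n` is supersymmetric if it is separately symmetric in
the `x`'s and in the `y`'s and if, for all `i` and `j`, the result of the specialization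
`x_i = -y_j = t` does not depend on `t`. -/
def IsSupersymmetric {m n : ℕ} (f : MvPolynomial (Fin m ⊕ Fin n) ℂ) : Prop :=
  (∀ (σ : Equiv.Perm (Fin m)) (τ : Equiv.Perm (Fin n)), rename (Sum.map σ τ) f = f) ∧
  ∀ (i : Fin m) (j : Fin n) (s t : ℂ), cancelSpec i j s f = cancelSpec i j t f

/-- The algebra of supersymmetric functions: the double projective limit, in the category of graded
algebras, of the algebras of supersymmetric polynomials under `x_{m+1} = 0` and `y_{n+1} = 0`.
Its elements are the compatible families of supersymmetric polynomials of bounded degree. -/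
def SuperSym : Subalgebra ℂ (∀ m n : ℕ, MvPolynomial (Fin m ⊕ Fin n) ℂ) where
  carrier := {f | (∀ m n, IsSupersymmetric (f m n)) ∧
    (∀ m n, specX m n (f (m + 1) n) = f m n) ∧
    (∀ m n, specY m n (f m (n + 1)) = f m n) ∧
    ∃ D, ∀ m n, (f m n).totalDegree ≤ D}
  mul_mem' := by
    rintro f g ⟨hf, hfx, hfy, D, hD⟩ ⟨hg, hgx, hgy, E, hE⟩
    refine ⟨fun m n => ⟨fun σ τ => ?_, fun i j s t => ?_⟩, fun m n => ?_, fun m n => ?_,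
      D + E, fun m n => (totalDegree_mul _ _).trans (add_le_add (hD m n) (hE m n))⟩
    · simp only [Pi.mul_apply, map_mul, (hf m n).1 σ τ, (hg m n).1 σ τ]
    · simp only [Pi.mul_apply, map_mul, (hf m n).2 i j s t, (hg m n).2 i j s t]
    · simp only [Pi.mul_apply, map_mul, hfx, hgx]
    · simp only [Pi.mul_apply, map_mul, hfy, hgy]
  add_mem' := by
    rintro f g ⟨hf, hfx, hfy, D, hD⟩ ⟨hg, hgx, hgy, E, hE⟩
    refine ⟨fun m n => ⟨fun σ τ => ?_, fun i j s t => ?_⟩, fun m n => ?_, fun m n => ?_,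
      max D E, fun m n => (totalDegree_add _ _).trans (max_le_max (hD m n) (hE m n))⟩
    · simp only [Pi.add_apply, map_add, (hf m n).1 σ τ, (hg m n).1 σ τ]
    · simp only [Pi.add_apply, map_add, (hf m n).2 i j s t, (hg m n).2 i j s t]
    · simp only [Pi.add_apply, map_add, hfx, hgx]
    · simp only [Pi.add_apply, map_add, hfy, hgy]
  algebraMap_mem' := by
    intro r
    refine ⟨fun m n => ⟨fun σ τ => ?_, fun i j s t => ?_⟩, fun m n => ?_, fun m n => ?_,
      0, fun m n => ?_⟩ <;>
    simp [Pi.algebraMap_apply, algebraMap_eq]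

/-- The supersymmetric power sum `p_k(x; y) = ∑ x_i ^ k + (-1) ^ (k - 1) ∑ y_j ^ k` with
`k = r + 1`, as an element of the algebra of supersymmetric functions. -/
def superPowerSum (r : ℕ) : SuperSym :=
  ⟨fun m n => ∑ i : Fin m, X (Sum.inl i) ^ (r + 1) + (-1) ^ r * ∑ j : Fin n, X (Sum.inr j) ^ (r + 1),
    by
    refine ⟨fun m n => ⟨fun σ τ => ?_, fun i j s t => ?_⟩, fun m n => ?_, fun m n => ?_,
      r + 1, fun m n => ?_⟩
    · simp only [map_add, map_sum, map_mul, map_pow, map_neg, map_one, rename_X, Sum.map_inl,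
        Sum.map_inr]
      rw [Equiv.sum_comp σ (fun i => (X (Sum.inl i) : MvPolynomial (Fin m ⊕ Fin n) ℂ) ^ (r + 1)),
        Equiv.sum_comp τ (fun i => (X (Sum.inr i) : MvPolynomial (Fin m ⊕ Fin n) ℂ) ^ (r + 1))]
    · have key : ∀ t : ℂ, cancelSpec i j t (∑ i : Fin m, X (Sum.inl i) ^ (r + 1) +
          (-1) ^ r * ∑ j : Fin n, X (Sum.inr j) ^ (r + 1)) =
          ∑ k ∈ Finset.univ.erase i, X (Sum.inl k) ^ (r + 1) +
          (-1) ^ r * ∑ k ∈ Finset.univ.erase j, X (Sum.inr k) ^ (r + 1) := by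
        intro t
        simp only [cancelSpec, map_add, map_sum, map_mul, map_pow, map_neg, map_one, aeval_X,
          Sum.elim_inl, Sum.elim_inr]
        rw [← Finset.add_sum_erase _ _ (Finset.mem_univ i),
          ← Finset.add_sum_erase _ _ (Finset.mem_univ j)]
        rw [Finset.sum_congr rfl (fun k hk => by
            rw [Function.update_of_ne (Finset.ne_of_mem_erase hk)] :
            ∀ k ∈ Finset.univ.erase i, _ = X (Sum.inl k) ^ (r + 1)),
          Finset.sum_congr rfl (fun k hk => by
            rw [Function.update_of_ne (Finset.ne_of_mem_erase hk)] :
            ∀ k ∈ Finset.univ.erase j, _ = X (Sum.inr k) ^ (r + 1))]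
        simp only [Function.update_self]
        have h1 : ((-1 : MvPolynomial (Fin m ⊕ Fin n) ℂ) ^ r) * (-1) ^ r = 1 := by
          rw [← mul_pow]; simp
        rw [neg_pow]
        linear_combination (-(C t : MvPolynomial (Fin m ⊕ Fin n) ℂ) ^ (r + 1)) * h1
      rw [key, key]
    · simp [specX, Fin.sum_univ_castSucc]
    · simp [specY, Fin.sum_univ_castSucc]
    · have hx : ∀ v : Fin m ⊕ Fin n,
          (X v ^ (r + 1) : MvPolynomial (Fin m ⊕ Fin n) ℂ).totalDegree ≤ r + 1 :=
        fun v => (totalDegree_X_pow v (r + 1)).le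
      refine (totalDegree_add _ _).trans (max_le ?_ ?_)
      · exact totalDegree_finsetSum_le fun i _ => hx _
      · refine (totalDegree_mul _ _).trans ?_
        have h0 : ((-1 : MvPolynomial (Fin m ⊕ Fin n) ℂ) ^ r).totalDegree = 0 := by
          rw [show (-1 : MvPolynomial (Fin m ⊕ Fin n) ℂ) ^ r = C ((-1) ^ r) by simp, totalDegree_C]
        rw [h0, zero_add]
        exact totalDegree_finsetSum_le fun i _ => hx _⟩

/-- The generating series `1 + ∑_{k ≥ 1} h_k t ^ k = exp (∑_{k ≥ 1} p_k t ^ k / k)` of the complete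
homogeneous supersymmetric functions. -/
def hSeries : PowerSeries SuperSym :=
  (PowerSeries.exp SuperSym).subst
    (PowerSeries.X * PowerSeries.mk fun r => ((r + 1 : ℂ)⁻¹) • superPowerSum r)

/-- The complete homogeneous supersymmetric function `h_k`. -/
def superH (k : ℕ) : SuperSym := PowerSeries.coeff k hSeries

/-! ### Shifted symmetric functions -/

/-- The specialization `x_{n+1} = 0`, from polynomials in `x_1, …, x_{n+1}` to polynomials in
`x_1, …, x_n`. -/
def spec (n : ℕ) : MvPolynomial (Fin (n + 1)) ℂ →ₐ[ℂ] MvPolynomial (Fin n) ℂ :=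
  aeval (Fin.snoc (α := fun _ => MvPolynomial (Fin n) ℂ) (fun i => X i) 0)

/-- The substitution `x_j = x'_j + j`, `j = 1, …, n`, which writes a polynomial in the `x_j` as a
polynomial in the shifted variables `x'_j = x_j - j`. (The index `j : Fin n` starts from `0`.) -/
def unshift (n : ℕ) : MvPolynomial (Fin n) ℂ →ₐ[ℂ] MvPolynomial (Fin n) ℂ :=
  aeval fun j : Fin n => X j + C ((j : ℂ) + 1)

/-- A polynomial in `x_1, …, x_n` is shifted symmetric if it is symmetric in the variables
`x_j - j`. -/
def IsShiftedSymmetric {n : ℕ} (f : MvPolynomial (Fin n) ℂ) : Prop :=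
  (unshift n f).IsSymmetric

/-- The algebra of shifted symmetric functions: the projective limit, in the category of filtered
algebras, of the algebras of shifted symmetric polynomials under `x_{n+1} = 0`. Its elements are
the compatible families of shifted symmetric polynomials of bounded degree. -/
def ShiftedSym : Subalgebra ℂ (∀ n : ℕ, MvPolynomial (Fin n) ℂ) where
  carrier := {f | (∀ n, IsShiftedSymmetric (f n)) ∧
    (∀ n, spec n (f (n + 1)) = f n) ∧
    ∃ D, ∀ n, (f n).totalDegree ≤ D}
  mul_mem' := by
    rintro f g ⟨hf, hfx, D, hD⟩ ⟨hg, hgx, E, hE⟩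
    refine ⟨fun n => ?_, fun n => ?_,
      D + E, fun n => (totalDegree_mul _ _).trans (add_le_add (hD n) (hE n))⟩
    · simp only [IsShiftedSymmetric, Pi.mul_apply, map_mul]
      exact (hf n).mul (hg n)
    · simp only [Pi.mul_apply, map_mul, hfx, hgx]
  add_mem' := by
    rintro f g ⟨hf, hfx, D, hD⟩ ⟨hg, hgx, E, hE⟩
    refine ⟨fun n => ?_, fun n => ?_,
      max D E, fun n => (totalDegree_add _ _).trans (max_le_max (hD n) (hE n))⟩
    · simp only [IsShiftedSymmetric, Pi.add_apply, map_add]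
      exact (hf n).add (hg n)
    · simp only [Pi.add_apply, map_add, hfx, hgx]
  algebraMap_mem' := by
    intro r
    refine ⟨fun n => ?_, fun n => ?_, 0, fun n => ?_⟩
    · simp only [IsShiftedSymmetric, Pi.algebraMap_apply, AlgHom.commutes]
      exact IsSymmetric.C r
    · simp
    · simp [algebraMap_eq]

/-- The falling factorial power `a (a - 1) ⋯ (a - k + 1)` of an element of a `ℂ`-algebra. -/
def fallingPow {A : Type*} [CommRing A] [Algebra ℂ A] (a : A) (k : ℕ) : A :=
  Polynomial.aeval a (descPochhammer ℂ k)

/-- The matrix with the entries `(x_i + n - i) ↓ (μ_j + n - j)`, `1 ≤ i, j ≤ n`, where `a ↓ k` is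
the falling factorial power. (The indices in the code start from `0`.) -/
def shiftedMatrix (μ : YoungDiagram) (n : ℕ) :
    Matrix (Fin n) (Fin n) (MvPolynomial (Fin n) ℂ) :=
  Matrix.of fun i j => fallingPow (X i + C ((n : ℂ) - 1 - (i : ℂ))) (μ.rowLen j + (n - 1 - j))

/-- `s` is the shifted Schur function `s*_μ`: for every `n` not smaller than the number of rows
of `μ`, the polynomial `s(x_1, …, x_n)` is the ratio
`det [(x_i + n - i) ↓ (μ_j + n - j)] / det [(x_i + n - i) ↓ (n - j)]`. -/
def IsShiftedSchur (μ : YoungDiagram) (s : ShiftedSym) : Prop :=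
  ∀ n : ℕ, μ.colLen 0 ≤ n →
    s.1 n * (shiftedMatrix ⊥ n).det = (shiftedMatrix μ n).det

/-- The shifted Schur function `s*_μ`. -/
def shiftedSchur (μ : YoungDiagram) : ShiftedSym :=
  Classical.epsilon (IsShiftedSchur μ)

/-- The Young diagram `(k)` with one row of length `k`. -/
def rowDiagram (k : ℕ) : YoungDiagram :=
  YoungDiagram.ofRowLens [k] (List.pairwise_singleton _ _).sortedGE

/-- The shifted analog `h*_k = s*_{(k)}` of the complete homogeneous symmetric function. -/
def shiftedH (k : ℕ) : ShiftedSym := shiftedSchur (rowDiagram k)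

/-! ### The isomorphism and the Frobenius-Schur functions -/

/-- The formal series `1 + ∑_{k ≥ 1} a_k g_k(t)` with coefficients in `A`, for elements `a_k` of `A`
and complex series `g_k(t)` divisible by `t ^ k`. -/
def expansion {A : Type*} [CommRing A] [Algebra ℂ A] (g : ℕ → PowerSeries ℂ) (a : ℕ → A) :
    PowerSeries A :=
  1 + PowerSeries.mk fun N => ∑ k ∈ Finset.Icc 1 N, PowerSeries.coeff N (g k) • a k

/-- The inverse falling factorial power `1 / (u (u - 1) ⋯ (u - k + 1))` as a formal series in
`t = 1 / u`. -/
def invFalling (k : ℕ) : PowerSeries ℂ :=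
  PowerSeries.X ^ k * (∏ l ∈ Finset.range k, (1 - PowerSeries.C (l : ℂ) * PowerSeries.X))⁻¹

/-- The function `1 / (u + r) ^ k` as a formal series in `t = 1 / u`. -/
def invShiftPow (r : ℂ) (k : ℕ) : PowerSeries ℂ :=
  PowerSeries.X ^ k * ((1 + PowerSeries.C r * PowerSeries.X) ^ k)⁻¹

/-- The generating series `H*(u) = 1 + ∑_{k ≥ 1} h*_k / (u (u - 1) ⋯ (u - k + 1))`, expanded in
powers of `1 / u`. -/
def HStar : PowerSeries ShiftedSym := expansion invFalling shiftedH

/-- The series `H(u + r) = 1 + ∑_{k ≥ 1} h_k / (u + r) ^ k`, expanded in powers of `1 / u`. -/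
def HShift (r : ℂ) : PowerSeries SuperSym := expansion (invShiftPow r) superH

/-- `φ` satisfies `φ(H*(u)) = H(u + 1/2)`. -/
def MapsHStar (φ : ShiftedSym →ₐ[ℂ] SuperSym) : Prop :=
  PowerSeries.map (φ : ShiftedSym →+* SuperSym) HStar = HShift (1 / 2)

instance : Nonempty (ShiftedSym →ₐ[ℂ] SuperSym) :=
  ⟨(Algebra.ofId ℂ SuperSym).comp ((aeval fun i : Fin 0 => i.elim0).comp
    ((Pi.evalAlgHom ℂ (fun n : ℕ => MvPolynomial (Fin n) ℂ) 0).comp ShiftedSym.val))⟩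

/-- The algebra homomorphism `φ` from shifted symmetric to supersymmetric functions that is
determined by `φ(H*(u)) = H(u + 1/2)`. -/
def phi : ShiftedSym →ₐ[ℂ] SuperSym := Classical.epsilon MapsHStar

/-- The Frobenius-Schur function `Fs_μ = φ(s*_μ)`. -/
def Fs (μ : YoungDiagram) : SuperSym := phi (shiftedSchur μ)

/-! ### Young diagrams -/

/-- The relative dimension `dim(μ, ν)`: if `μ ⊆ ν`, the number of chains of diagrams
`μ = λ⁰ ⊂ λ¹ ⊂ … ⊂ λᵏ = ν` with `k = |ν| - |μ|`; otherwise `0`. -/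
def relDim (μ ν : YoungDiagram) : ℕ :=
  open Classical in
  if μ ≤ ν then
    Set.ncard {c : LTSeries YoungDiagram | c.head = μ ∧ c.last = ν ∧ c.length = ν.card - μ.card}
  else 0

/-- The dimension `dim ν = dim(∅, ν)`, the number of standard tableaux of shape `ν`. -/
def dim (ν : YoungDiagram) : ℕ := relDim ⊥ ν

/-- The number of diagonal squares of a diagram. -/
def depth (ν : YoungDiagram) : ℕ := (ν.cells.filter fun c => c.1 = c.2).card

/-- The value `F(p_1 + 1/2, …, p_d + 1/2; q_1 + 1/2, …, q_d + 1/2)` of a supersymmetric function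
at the modified Frobenius coordinates of a diagram `ν = (p_1, …, p_d | q_1, …, q_d)`, where
`p_i = ν_i - i` and `q_i = ν'_i - i`. (The index `i` in the code starts from `0`.) -/
def evalFrobenius (F : SuperSym) (ν : YoungDiagram) : ℂ :=
  MvPolynomial.eval
    (Sum.elim (fun i : Fin (depth ν) => (ν.rowLen i : ℂ) - ((i : ℂ) + 1) + 1 / 2)
      (fun i : Fin (depth ν) => (ν.colLen i : ℂ) - ((i : ℂ) + 1) + 1 / 2))
    (F.1 (depth ν) (depth ν))

end FrobeniusSchur

end

open FrobeniusSchur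

noncomputable section

namespace FrobeniusSchur

open MvPolynomial

/-! ### Falling powers -/

section FallingPow

variable {A B : Type*} [CommRing A] [Algebra ℂ A] [CommRing B] [Algebra ℂ B]

/-! The proof compares two evaluations at a diagram `ν`: that of a shifted symmetric function at the
row lengths (`diagramEval`), and that of a supersymmetric function at the modified Frobenius
coordinates. On the shifted side, writing the $h^*_k$ as determinants that differ only in the first
column and summing over $k$ gives $H^*(u)=\prod_i (u+i)/(u+i-x_i)$ (`map_HStar_mul`). On the other
side, $H(u+\frac12)=\prod_j(u+\frac12+y_j)/\prod_i(u+\frac12-x_i)$ (`map_HShift_mul`). At a diagram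
both become $\prod_i (u+q_i+1)/(u-p_i)$, because the numbers $q_i+1$, $i\le d$, and $i-\nu_i$,
$d<i\le n$, together exhaust $1,\dots,n$ for every $n$ not smaller than the number of rows
(`prod_frobenius`, `map_frobeniusEval_HShift_eq`).

Two structural facts turn this identity of series into a homomorphism. The coefficients of $H^*(u)$
generate the algebra of shifted symmetric functions (`eq_top_of_coeff_HStar_mem`), and a
supersymmetric function is determined by its values at large diagrams (`superSym_ext`). By the
first, every shifted symmetric function has a supersymmetric function with the same values at
diagrams. By the second that function is unique, so the assignment is multiplicative and linear and
sends $H^*(u)$ to $H(u+\frac12)$. Algebraic independence of the $h^*_k$ is never needed. Hence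
$Fs_\mu$ at Frobenius coordinates equals $s^*_\mu(\nu)$ (`evalFrobenius_Fs`).

It remains to compute $s^*_\mu(\nu)$. With $l_i=\nu_i+N-i$ and $m_j=\mu_j+N-j$, the branching rule
and an identity for $\det[l_i^{\downarrow m_j}]$ give $\dim(\mu,\nu)\prod_i
l_i!=(|\nu|-|\mu|)!\,\det[l_i^{\downarrow m_j}]$ (`relDim_mul_prod_factorial`). Dividing by the case
$\mu=\varnothing$ leaves the ratio of determinants that defines $s^*_\mu$ (`relDim_div_dim`). If
$\mu\not\subseteq\nu$, the determinant vanishes because of a block of zeros. Uniqueness in the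
theorem is again `superSym_ext`. -/

@[simp] theorem fallingPow_zero (a : A) : fallingPow a 0 = 1 := by simp [fallingPow]

theorem fallingPow_succ (a : A) (k : ℕ) : fallingPow a (k + 1) = fallingPow a k * (a - k) := by
  simp [fallingPow, descPochhammer_succ_right]

theorem fallingPow_add_one_succ (a : A) (k : ℕ) :
    fallingPow (a + 1) (k + 1) = (a + 1) * fallingPow a k := by
  simp [fallingPow, descPochhammer_succ_left, Polynomial.aeval_comp]

theorem fallingPow_zero_succ (k : ℕ) : fallingPow (0 : A) (k + 1) = 0 := by
  simp [fallingPow, descPochhammer_succ_left]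

theorem map_fallingPow (f : A →ₐ[ℂ] B) (a : A) (k : ℕ) :
    f (fallingPow a k) = fallingPow (f a) k :=
  (Polynomial.aeval_algHom_apply f a _).symm

theorem fallingPow_eq_eval (a : A) (k : ℕ) : fallingPow a k = (descPochhammer A k).eval a := by
  rw [fallingPow, Polynomial.aeval_def, ← descPochhammer_map (algebraMap ℂ A), Polynomial.eval_map]

theorem fallingPow_natCast (l k : ℕ) : fallingPow (l : ℂ) k = (l.descFactorial k : ℂ) := by
  rw [fallingPow_eq_eval, descPochhammer_eval_eq_descFactorial]

/-- Falling powers are monic of the right degrees, so column operations reduce them to monomials.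
Reversing rows and columns simultaneously orders the exponents increasingly without a sign. -/
theorem det_fallingPow_rev [IsDomain A] {n : ℕ} (v : Fin n → A) :
    (Matrix.of fun i j : Fin n => fallingPow (v i) (n - 1 - j)).det =
      (Matrix.vandermonde (v ∘ Fin.rev)).det := by
  rw [← Matrix.det_submatrix_equiv_self Fin.revPerm]
  rw [Matrix.det_eval_matrixOfPolynomials_eq_det_vandermonde (v ∘ Fin.rev)
    (fun j => descPochhammer A j) (fun j => (descPochhammer_natDegree A j)) (fun j => monic_descPochhammer A j)]
  congr 1
  ext i j
  simp only [Matrix.submatrix_apply, Matrix.of_apply, Fin.revPerm_apply, fallingPow_eq_eval,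
    Function.comp]
  congr 2
  rw [Fin.val_rev]; omega

end FallingPow

/-! ### Linear forms dividing polynomials -/

section LinearForms

variable {σ : Type*} [DecidableEq σ]

/-- The substitution `x_j = q`. -/
def substVar (j : σ) (q : MvPolynomial σ ℂ) : MvPolynomial σ ℂ →ₐ[ℂ] MvPolynomial σ ℂ :=
  aeval (Function.update X j q)

/-- Modulo $x_j-q$ the substitution fixes every variable, hence every polynomial. -/
theorem X_sub_dvd_sub_substVar (j : σ) (q p : MvPolynomial σ ℂ) :
    X j - q ∣ p - substVar j q p := by
  rw [← Ideal.mem_span_singleton, ← Ideal.Quotient.eq]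
  have : (Ideal.Quotient.mkₐ ℂ (Ideal.span {X j - q})) =
      (Ideal.Quotient.mkₐ ℂ (Ideal.span {X j - q})).comp (substVar j q) := by
    ext i
    simp only [AlgHom.comp_apply, substVar, aeval_X]
    by_cases h : i = j
    · subst h
      simp only [Function.update_self, Ideal.Quotient.mkₐ_eq_mk]
      rw [Ideal.Quotient.eq]
      exact Ideal.mem_span_singleton_self _
    · simp [Function.update_of_ne h]
  exact DFunLike.congr_fun this p

theorem X_sub_dvd_iff {j : σ} {q : MvPolynomial σ ℂ} (hq : substVar j q q = q)
    (p : MvPolynomial σ ℂ) : X j - q ∣ p ↔ substVar j q p = 0 := by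
  constructor
  · rintro ⟨r, rfl⟩
    rw [map_mul, map_sub, hq]
    simp [substVar]
  · intro h
    simpa [h] using X_sub_dvd_sub_substVar j q p

/-- The multiples of this form are the kernel of a homomorphism into a domain. -/
theorem prime_X_sub {j : σ} {q : MvPolynomial σ ℂ} (hq : substVar j q q = q)
    (h0 : X j - q ≠ 0) : Prime (X j - q) := by
  refine ⟨h0, fun h => ?_, fun a b h => ?_⟩
  · have := (X_sub_dvd_iff hq 1).1 h.dvd
    simp at this
  · rw [X_sub_dvd_iff hq, map_mul, mul_eq_zero] at h
    rwa [X_sub_dvd_iff hq, X_sub_dvd_iff hq]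

end LinearForms

theorem totalDegree_aeval_le {σ τ : Type*} (g : σ → MvPolynomial τ ℂ)
    (hg : ∀ i, (g i).totalDegree ≤ 1) (p : MvPolynomial σ ℂ) :
    (aeval g p).totalDegree ≤ p.totalDegree := by
  rw [aeval_def, eval₂_eq]
  refine totalDegree_finsetSum_le fun d hd => ?_
  refine (totalDegree_mul _ _).trans ?_
  rw [algebraMap_eq, totalDegree_C, zero_add]
  refine (totalDegree_finsetProd _ _).trans ?_
  refine le_trans (Finset.sum_le_sum fun i _ => (totalDegree_pow _ _).trans
    (Nat.mul_le_mul_left _ (hg i))) ?_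
  simpa [Finsupp.sum] using le_totalDegree hd

theorem prod_dvd_of_prime {ι σ : Type*} (s : Finset ι) (f : ι → MvPolynomial σ ℂ)
    (p : MvPolynomial σ ℂ) (hf : ∀ i ∈ s, Prime (f i))
    (hne : ∀ i ∈ s, ∀ j ∈ s, i ≠ j → ¬ f i ∣ f j) (hp : ∀ i ∈ s, f i ∣ p) :
    ∏ i ∈ s, f i ∣ p := by
  refine Finset.prod_dvd_of_isRelPrime (fun i hi j hj hij => ?_) hp
  exact ((hf i hi).irreducible.isRelPrime_iff_not_dvd).2 (hne i hi j hj hij)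

/-! ### Row lengths of Young diagrams -/

@[simp] theorem rowLen_bot (j : ℕ) : (⊥ : YoungDiagram).rowLen j = 0 := by
  by_contra h
  exact YoungDiagram.notMem_bot (j, 0) (YoungDiagram.mem_iff_lt_rowLen.2 (Nat.pos_of_ne_zero h))

theorem rowLen_eq_zero {μ : YoungDiagram} {j : ℕ} (h : μ.colLen 0 ≤ j) : μ.rowLen j = 0 := by
  by_contra h'
  have := YoungDiagram.mem_iff_lt_colLen.1
    (YoungDiagram.mem_iff_lt_rowLen.2 (Nat.pos_of_ne_zero h'))
  omega

theorem colLen_zero_le_iff {μ : YoungDiagram} {n : ℕ} : μ.colLen 0 ≤ n ↔ μ.rowLen n = 0 := by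
  refine ⟨rowLen_eq_zero, fun h => ?_⟩
  by_contra h'
  have := YoungDiagram.mem_iff_lt_rowLen.1 (YoungDiagram.mem_iff_lt_colLen.2 (not_le.1 h'))
  omega

theorem sum_rowLen {μ : YoungDiagram} {n : ℕ} (h : μ.colLen 0 ≤ n) :
    ∑ i : Fin n, μ.rowLen i = μ.card := by
  rw [Fin.sum_univ_eq_sum_range (fun i => μ.rowLen i) n, YoungDiagram.card]
  rw [Finset.card_eq_sum_card_fiberwise (f := Prod.fst) (t := Finset.range n)]
  · refine Finset.sum_congr rfl fun i _ => ?_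
    rw [YoungDiagram.rowLen_eq_card, YoungDiagram.row]
  · rintro ⟨i, j⟩ hc
    have h1 : (i, j) ∈ μ := hc
    have h2 := YoungDiagram.mem_iff_lt_colLen.1 (μ.up_left_mem le_rfl (Nat.zero_le j) h1)
    simp only [Finset.coe_range, Set.mem_Iio]
    omega

/-! ### The determinants -/

/-- The variable `x_i + n - i`. -/
def ell (n : ℕ) (i : Fin n) : MvPolynomial (Fin n) ℂ := X i + C ((n : ℂ) - 1 - (i : ℂ))

theorem shiftedMatrix_apply (μ : YoungDiagram) (n : ℕ) (i j : Fin n) :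
    shiftedMatrix μ n i j = fallingPow (ell n i) (μ.rowLen j + (n - 1 - j)) := rfl

theorem exists_eval_ell {n : ℕ} (w : Fin n → ℂ) : ∃ x : Fin n → ℂ, ∀ i, eval x (ell n i) = w i :=
  ⟨fun i => w i - ((n : ℂ) - 1 - (i : ℂ)), fun i => by simp [ell]⟩

theorem shiftedMatrix_bot_det (n : ℕ) : (shiftedMatrix ⊥ n).det =
    (Matrix.vandermonde (ell n ∘ Fin.rev)).det := by
  rw [← det_fallingPow_rev]
  congr 1
  ext1 i j
  simp [shiftedMatrix_apply]

theorem shiftedMatrix_bot_det_eq_prod (n : ℕ) : (shiftedMatrix ⊥ n).det =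
    ∏ p : (Σ _ : Fin n, Fin n) with p.1 < p.2, (ell n p.2.rev - ell n p.1.rev) := by
  rw [shiftedMatrix_bot_det, Matrix.det_vandermonde, Finset.prod_sigma']
  refine Finset.prod_congr ?_ fun _ _ => rfl
  ext ⟨i, j⟩
  simp

theorem ell_sub_ell {n : ℕ} (a b : Fin n) :
    ell n a - ell n b = X a - (X b + C ((a : ℂ) - (b : ℂ))) := by
  simp only [ell, map_sub]; ring

theorem substVar_X_add_C {n : ℕ} {a b : Fin n} (h : a ≠ b) (q : MvPolynomial (Fin n) ℂ) (c : ℂ) :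
    substVar a q (X b + C c) = X b + C c := by
  simp [substVar, Function.update_of_ne h.symm]

theorem ell_injective (n : ℕ) : Function.Injective (ell n) := by
  intro a b h
  obtain ⟨x, hx⟩ := exists_eval_ell (fun i : Fin n => (i : ℂ))
  have := congrArg (eval x) h
  rw [hx, hx] at this
  exact Fin.ext (by exact_mod_cast this)

theorem prime_ell_sub_ell {n : ℕ} {a b : Fin n} (h : a ≠ b) : Prime (ell n a - ell n b) := by
  have h0 : ell n a - ell n b ≠ 0 := sub_ne_zero.2 fun e => h (ell_injective n e)
  rw [ell_sub_ell] at h0 ⊢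
  exact prime_X_sub (substVar_X_add_C h _ _) h0

theorem shiftedMatrix_bot_det_ne_zero (n : ℕ) : (shiftedMatrix ⊥ n).det ≠ 0 := by
  rw [shiftedMatrix_bot_det, Matrix.det_vandermonde_ne_zero_iff]
  exact (ell_injective n).comp Fin.rev_injective

/-- Setting $\ell_a=\ell_b$ makes two rows equal. -/
theorem ell_sub_ell_dvd_det {n : ℕ} (μ : YoungDiagram) {a b : Fin n} (h : a ≠ b) :
    ell n a - ell n b ∣ (shiftedMatrix μ n).det := by
  rw [ell_sub_ell, X_sub_dvd_iff (substVar_X_add_C h _ _), AlgHom.map_det]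
  refine Matrix.det_zero_of_row_eq h ?_
  ext1 j
  simp only [AlgHom.mapMatrix_apply, Matrix.map_apply, shiftedMatrix_apply, map_fallingPow]
  congr 1
  simp only [ell, substVar, map_add, aeval_X, algHom_C, Function.update_self,
    Function.update_of_ne h.symm, algebraMap_eq, map_sub]
  ring

/-- At a point where the $\ell$'s are the indicator of an index outside $\{a,b\}$, the divisor
vanishes while the other form is $\pm1$. -/
theorem not_ell_sub_ell_dvd {n : ℕ} {a b c d : Fin n} (hcd : c ≠ d)
    (h : (c ≠ a ∧ c ≠ b) ∨ (d ≠ a ∧ d ≠ b)) : ¬ ell n a - ell n b ∣ ell n c - ell n d := by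
  rintro ⟨r, hr⟩
  rcases h with h | h
  · obtain ⟨x, hx⟩ := exists_eval_ell (Pi.single c (1 : ℂ) : Fin n → ℂ)
    have := congrArg (eval x) hr
    simp [hx, h.1.symm, h.2.symm, hcd.symm] at this
  · obtain ⟨x, hx⟩ := exists_eval_ell (Pi.single d (1 : ℂ) : Fin n → ℂ)
    have := congrArg (eval x) hr
    simp [hx, h.1.symm, h.2.symm, hcd] at this

theorem shiftedMatrix_bot_det_dvd (μ : YoungDiagram) (n : ℕ) :
    (shiftedMatrix ⊥ n).det ∣ (shiftedMatrix μ n).det := by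
  rw [shiftedMatrix_bot_det_eq_prod]
  refine prod_dvd_of_prime _ _ _ ?_ ?_ ?_
  · rintro ⟨i, j⟩ h
    simp only [Finset.mem_filter, Finset.mem_univ, true_and] at h
    exact prime_ell_sub_ell (Fin.rev_injective.ne h.ne')
  · rintro ⟨i, j⟩ h ⟨k, l⟩ h' hne
    simp only [Finset.mem_filter, Finset.mem_univ, true_and] at h h'
    refine not_ell_sub_ell_dvd (Fin.rev_injective.ne h'.ne') ?_
    simp only [ne_eq, Fin.rev_inj]
    by_contra hcon
    apply hne
    have h1 : i = k ∧ j = l := by omega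
    rw [h1.1, h1.2]
  · rintro ⟨i, j⟩ h
    simp only [Finset.mem_filter, Finset.mem_univ, true_and] at h
    exact ell_sub_ell_dvd_det μ (Fin.rev_injective.ne h.ne')

theorem totalDegree_X_add_C_le {σ : Type*} (i : σ) (c : ℂ) :
    (X i + C c : MvPolynomial σ ℂ).totalDegree ≤ 1 := by
  refine (totalDegree_add _ _).trans ?_
  simp

theorem totalDegree_ell_sub_ell {n : ℕ} {a b : Fin n} (h : a ≠ b) :
    (ell n a - ell n b).totalDegree = 1 := by
  refine le_antisymm ?_ ?_
  · exact (totalDegree_sub _ _).trans (max_le (totalDegree_X_add_C_le _ _)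
      (totalDegree_X_add_C_le _ _))
  · by_contra hlt
    have h0 : (ell n a - ell n b).totalDegree = 0 := by omega
    rw [totalDegree_eq_zero_iff_eq_C] at h0
    obtain ⟨x, hx⟩ := exists_eval_ell (Pi.single a (1 : ℂ) : Fin n → ℂ)
    obtain ⟨y, hy⟩ := exists_eval_ell (0 : Fin n → ℂ)
    have h1 := congrArg (eval x) h0
    have h2 := congrArg (eval y) h0
    simp only [map_sub, hx, hy, eval_C, Pi.single_eq_same, Pi.single_eq_of_ne h.symm,
      Pi.zero_apply] at h1 h2
    rw [← h2] at h1
    norm_num at h1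

theorem totalDegree_prod_eq {ι σ : Type*} (s : Finset ι) (f : ι → MvPolynomial σ ℂ)
    (h : ∀ i ∈ s, (f i).totalDegree = 1) : (∏ i ∈ s, f i).totalDegree = s.card := by
  classical
  have h0 : ∀ i ∈ s, f i ≠ 0 := fun i hi e => by have := h i hi; simp [e] at this
  induction s using Finset.induction_on with
  | empty => simp
  | insert a s ha ih =>
    rw [Finset.prod_insert ha, Finset.card_insert_of_notMem ha,
      totalDegree_mul_of_isDomain (h0 a (by simp))
      (Finset.prod_ne_zero_iff.2 fun i hi => h0 i (by simp [hi])), h a (by simp),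
      ih (fun i hi => h i (by simp [hi])) (fun i hi => h0 i (by simp [hi])), add_comm]

theorem totalDegree_shiftedMatrix_bot_det (n : ℕ) :
    (shiftedMatrix ⊥ n).det.totalDegree = ∑ j : Fin n, (n - 1 - (j : ℕ)) := by
  rw [shiftedMatrix_bot_det_eq_prod, totalDegree_prod_eq]
  · have : (Finset.univ.filter fun p : (Σ _ : Fin n, Fin n) => p.1 < p.2) =
        Finset.univ.sigma fun i => Finset.Ioi i := by
      ext ⟨i, j⟩; simp
    rw [this, Finset.card_sigma]
    refine Finset.sum_congr rfl fun i _ => ?_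
    rw [Fin.card_Ioi]
  · rintro ⟨i, j⟩ h
    simp only [Finset.mem_filter, Finset.mem_univ, true_and] at h
    exact totalDegree_ell_sub_ell (Fin.rev_injective.ne h.ne')

theorem totalDegree_fallingPow_le {σ : Type*} {p : MvPolynomial σ ℂ} (hp : p.totalDegree ≤ 1)
    (k : ℕ) : (fallingPow p k).totalDegree ≤ k := by
  induction k with
  | zero => simp
  | succ k ih =>
    rw [fallingPow_succ]
    refine (totalDegree_mul _ _).trans (add_le_add ih ?_)
    refine (totalDegree_sub _ _).trans (max_le hp ?_)
    rw [← map_natCast (C : ℂ →+* MvPolynomial σ ℂ), totalDegree_C]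
    exact zero_le_one

theorem totalDegree_det_le {σ : Type*} {n : ℕ} (M : Matrix (Fin n) (Fin n) (MvPolynomial σ ℂ))
    (d : Fin n → ℕ) (h : ∀ i j, (M i j).totalDegree ≤ d j) :
    M.det.totalDegree ≤ ∑ j, d j := by
  rw [Matrix.det_apply]
  refine totalDegree_finsetSum_le fun s _ => ?_
  refine (totalDegree_smul_le _ _).trans ?_
  exact (totalDegree_finsetProd _ _).trans (Finset.sum_le_sum fun i _ => h _ _)

theorem totalDegree_shiftedMatrix_det_le (μ : YoungDiagram) (n : ℕ) :
    (shiftedMatrix μ n).det.totalDegree ≤ ∑ j : Fin n, (μ.rowLen j + (n - 1 - (j : ℕ))) :=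
  totalDegree_det_le _ _ fun _ _ => totalDegree_fallingPow_le (totalDegree_X_add_C_le _ _) _

theorem unshift_ell {n : ℕ} (i : Fin n) : unshift n (ell n i) = X i + C (n : ℂ) := by
  simp only [ell, unshift, map_add, map_sub, aeval_X, algHom_C, algebraMap_eq, map_one]
  ring

/-- In the shifted variables $\ell_i$ becomes $x_i+n$, with a constant independent of $i$, so
permuting the variables permutes the rows. -/
theorem rename_unshift_det (μ : YoungDiagram) (n : ℕ) (σ : Equiv.Perm (Fin n)) :
    rename σ (unshift n (shiftedMatrix μ n).det) =
      ((Equiv.Perm.sign σ : ℤ) : MvPolynomial (Fin n) ℂ) * unshift n (shiftedMatrix μ n).det := by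
  rw [AlgHom.map_det, AlgHom.map_det, ← Matrix.det_permute]
  congr 1
  ext1 i j
  simp only [AlgHom.mapMatrix_apply, Matrix.map_apply, Matrix.submatrix_apply,
    shiftedMatrix_apply, map_fallingPow, id]
  congr 1
  rw [unshift_ell, unshift_ell]
  simp

theorem unshift_eval {n : ℕ} (y : Fin n → ℂ) (f : MvPolynomial (Fin n) ℂ) :
    eval y (unshift n f) = eval (fun j => y j + ((j : ℂ) + 1)) f := by
  rw [unshift, ← aeval_eq_eval, ← aeval_eq_eval, ← AlgHom.comp_apply, comp_aeval]
  simp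

theorem unshift_injective (n : ℕ) : Function.Injective (unshift n) := by
  intro f g h
  refine MvPolynomial.funext fun x => ?_
  have := congrArg (eval fun j => x j - ((j : ℂ) + 1)) h
  simpa [unshift_eval] using this

/-- The ratio of the determinants is a shifted symmetric polynomial. -/
theorem exists_schurPoly (μ : YoungDiagram) (n : ℕ) :
    ∃ s : MvPolynomial (Fin n) ℂ, s * (shiftedMatrix ⊥ n).det = (shiftedMatrix μ n).det ∧
      IsShiftedSymmetric s ∧ s.totalDegree ≤ ∑ j : Fin n, μ.rowLen j := by
  obtain ⟨s, hs⟩ := shiftedMatrix_bot_det_dvd μ n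
  rw [mul_comm] at hs
  refine ⟨s, hs.symm, fun σ => ?_, ?_⟩
  -- Numerator and denominator acquire the same sign, so their ratio is symmetric.
  · have h1 := rename_unshift_det μ n σ
    rw [hs, map_mul, map_mul, rename_unshift_det] at h1
    have h2 : ((Equiv.Perm.sign σ : ℤ) : MvPolynomial (Fin n) ℂ) ≠ 0 := by simp
    have h3 : unshift n (shiftedMatrix ⊥ n).det ≠ 0 := by
      rw [map_ne_zero_iff _ (unshift_injective n)]
      exact shiftedMatrix_bot_det_ne_zero n
    refine mul_right_cancel₀ (mul_ne_zero h2 h3) ?_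
    rw [h1]; ring
  · by_cases h0 : s = 0
    · simp [h0]
    have h1 := totalDegree_shiftedMatrix_det_le μ n
    rw [hs, totalDegree_mul_of_isDomain h0 (shiftedMatrix_bot_det_ne_zero n),
      totalDegree_shiftedMatrix_bot_det, Finset.sum_add_distrib] at h1
    omega

/-! ### Shifted symmetric polynomials and specializations -/

theorem eval_aeval {σ τ : Type*} (g : σ → MvPolynomial τ ℂ) (x : τ → ℂ) (p : MvPolynomial σ ℂ) :
    eval x (aeval g p) = eval (fun i => eval x (g i)) p := by
  rw [← aeval_eq_eval, ← aeval_eq_eval, ← AlgHom.comp_apply, comp_aeval]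

theorem isShiftedSymmetric_iff {n : ℕ} {f : MvPolynomial (Fin n) ℂ} :
    IsShiftedSymmetric f ↔ ∀ (σ : Equiv.Perm (Fin n)) (y : Fin n → ℂ),
      eval (fun j => y (σ j) + ((j : ℂ) + 1)) f = eval (fun j => y j + ((j : ℂ) + 1)) f := by
  refine forall_congr' fun σ => ?_
  constructor
  · intro h y
    have := congrArg (eval y) h
    rwa [eval_rename, unshift_eval, unshift_eval] at this
  · intro h
    refine MvPolynomial.funext fun y => ?_
    rw [eval_rename, unshift_eval, unshift_eval]
    exact h y

theorem eval_spec {n : ℕ} (x : Fin n → ℂ) (f : MvPolynomial (Fin (n + 1)) ℂ) :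
    eval x (spec n f) = eval (Fin.snoc (α := fun _ => ℂ) x 0) f := by
  rw [spec, eval_aeval]
  congr 2
  ext1 i
  refine Fin.lastCases ?_ (fun i => ?_) i <;> simp

theorem IsShiftedSymmetric.spec {n : ℕ} {f : MvPolynomial (Fin (n + 1)) ℂ}
    (hf : IsShiftedSymmetric f) : IsShiftedSymmetric (spec n f) := by
  rw [isShiftedSymmetric_iff] at hf ⊢
  intro σ y
  -- The permutation is extended by fixing the last index. The value $-(n+1)$ of the last shifted
  -- variable is the one for which $x_{n+1}=0$.
  have h := hf (finSuccEquivLast.symm.permCongr (Equiv.optionCongr σ))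
    (Fin.snoc (α := fun _ => ℂ) y (-((n : ℂ) + 1)))
  rw [eval_spec, eval_spec]
  convert h using 2 <;> congr 1 <;> ext1 i <;> refine Fin.lastCases ?_ (fun i => ?_) i <;>
    simp [Equiv.permCongr_apply]

theorem totalDegree_spec_le {n : ℕ} (f : MvPolynomial (Fin (n + 1)) ℂ) :
    (spec n f).totalDegree ≤ f.totalDegree := by
  refine totalDegree_aeval_le _ (fun i => ?_) f
  refine Fin.lastCases ?_ (fun i => ?_) i <;> simp

/-- The specialization `x_{n+1} = ⋯ = x_N = 0`. -/
def specTo (N n : ℕ) : MvPolynomial (Fin N) ℂ →ₐ[ℂ] MvPolynomial (Fin n) ℂ :=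
  aeval fun i => if h : (i : ℕ) < n then X ⟨i, h⟩ else 0

theorem specTo_self (n : ℕ) (f : MvPolynomial (Fin n) ℂ) : specTo n n f = f := by
  simp [specTo]

theorem spec_specTo (N n : ℕ) (f : MvPolynomial (Fin N) ℂ) :
    spec n (specTo N (n + 1) f) = specTo N n f := by
  rw [← AlgHom.comp_apply]
  congr 1
  ext1 i
  simp only [specTo, spec, AlgHom.comp_apply, aeval_X]
  by_cases h : (i : ℕ) < n
  · have h' : (i : ℕ) < n + 1 := by omega
    rw [dif_pos h, dif_pos h', aeval_X]
    exact Fin.snoc_castSucc (α := fun _ => MvPolynomial (Fin n) ℂ) _ _ ⟨i, h⟩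
  · rw [dif_neg h]
    by_cases h' : (i : ℕ) < n + 1
    · rw [dif_pos h', aeval_X]
      have : (⟨i, h'⟩ : Fin (n + 1)) = Fin.last n := by
        ext; simp only [Fin.val_last]; omega
      rw [this]
      exact Fin.snoc_last (α := fun _ => MvPolynomial (Fin n) ℂ) _ _
    · rw [dif_neg h', map_zero]

/-- A stable family of shifted symmetric polynomials, given for large `n`, extends to a shifted
symmetric function. -/
theorem exists_shiftedSym_of_stable (L D : ℕ) (f : ∀ n, MvPolynomial (Fin n) ℂ)
    (hsym : ∀ n, L ≤ n → IsShiftedSymmetric (f n))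
    (hspec : ∀ n, L ≤ n → spec n (f (n + 1)) = f n)
    (hdeg : ∀ n, L ≤ n → (f n).totalDegree ≤ D) :
    ∃ F : ShiftedSym, ∀ n, L ≤ n → F.1 n = f n := by
  let F : ∀ n, MvPolynomial (Fin n) ℂ := fun n => if L ≤ n then f n else specTo L n (f L)
  have hF : ∀ n, L ≤ n → F n = f n := fun n hn => if_pos hn
  have hFlow : ∀ n, n ≤ L → F n = specTo L n (f L) := by
    intro n hn
    rcases hn.lt_or_eq with h | rfl
    · exact if_neg (by omega)
    · rw [hF _ le_rfl, specTo_self]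
  have hFspec : ∀ n, spec n (F (n + 1)) = F n := by
    intro n
    by_cases h : L ≤ n
    · rw [hF _ h, hF _ (by omega), hspec n h]
    · rw [hFlow n (by omega), hFlow (n + 1) (by omega), spec_specTo]
  have hlow : ∀ k, IsShiftedSymmetric (F (L - k)) ∧ (F (L - k)).totalDegree ≤ D := by
    intro k
    induction k with
    | zero => rw [Nat.sub_zero, hF _ le_rfl]; exact ⟨hsym _ le_rfl, hdeg _ le_rfl⟩
    | succ k ih =>
      by_cases h : L ≤ k
      · rwa [show L - (k + 1) = L - k by omega]
      · rw [show L - k = L - (k + 1) + 1 by omega] at ih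
        rw [← hFspec]
        exact ⟨ih.1.spec, (totalDegree_spec_le _).trans ih.2⟩
  have hall : ∀ n, IsShiftedSymmetric (F n) ∧ (F n).totalDegree ≤ D := by
    intro n
    by_cases h : L ≤ n
    · rw [hF _ h]; exact ⟨hsym _ h, hdeg _ h⟩
    · have := hlow (L - n)
      rwa [show L - (L - n) = n by omega] at this
  exact ⟨⟨F, fun n => (hall n).1, hFspec, D, fun n => (hall n).2⟩, hF⟩

theorem spec_shiftedSym (f : ShiftedSym) (n : ℕ) : spec n (f.1 (n + 1)) = f.1 n := f.2.2.1 n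

theorem shiftedSym_ext_of_large {f g : ShiftedSym} (L : ℕ) (h : ∀ n, L ≤ n → f.1 n = g.1 n) :
    f = g := by
  have key : ∀ k n, L ≤ n + k → f.1 n = g.1 n := by
    intro k
    induction k with
    | zero => exact fun n hn => h n hn
    | succ k ih =>
      intro n hn
      rw [← spec_shiftedSym f, ← spec_shiftedSym g, ih (n + 1) (by omega)]
  exact Subtype.ext (funext fun n => key L n (by omega))

/-! ### Existence and uniqueness of the shifted Schur functions -/

/-- For $x_{n+1}=0$ the last row becomes $(0,\dots,0,1)$, and in the other rows $\ell_i$ becomes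
$\ell_i+1$, which splits off a factor $\ell_i+1$. These factors do not depend on `μ`, so they cancel
in the ratio with the determinant for `⊥`. -/
theorem spec_shiftedMatrix_det {μ : YoungDiagram} {n : ℕ} (h : μ.colLen 0 ≤ n) :
    spec n (shiftedMatrix μ (n + 1)).det =
      (∏ i : Fin n, (ell n i + 1)) * (shiftedMatrix μ n).det := by
  have hlast : spec n (ell (n + 1) (Fin.last n)) = 0 := by
    simp [ell, spec]
  have hcast : ∀ i : Fin n, spec n (ell (n + 1) i.castSucc) = ell n i + 1 := by
    intro i
    simp only [ell, spec, map_add, aeval_X, Fin.snoc_castSucc, algHom_C, algebraMap_eq,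
      Fin.val_castSucc, add_assoc]
    rw [← C_1, ← C_add]
    congr 2
    push_cast; ring
  rw [AlgHom.map_det, Matrix.det_succ_row _ (Fin.last n), Fin.sum_univ_castSucc,
    Finset.sum_eq_zero, zero_add]
  · have h1 : ((spec n).mapMatrix (shiftedMatrix μ (n + 1))) (Fin.last n) (Fin.last n) = 1 := by
      simp only [AlgHom.mapMatrix_apply, Matrix.map_apply, shiftedMatrix_apply, map_fallingPow,
        hlast, Fin.val_last, rowLen_eq_zero h]
      simp
    rw [h1, Even.neg_one_pow (by simp), one_mul, one_mul, Fin.succAbove_last,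
      ← Matrix.det_mul_column]
    congr 1
    ext1 i j
    simp only [AlgHom.mapMatrix_apply, Matrix.map_apply, shiftedMatrix_apply, map_fallingPow,
      Matrix.submatrix_apply, hcast, Matrix.of_apply, Fin.val_castSucc]
    rw [← fallingPow_add_one_succ]
    congr 1
    omega
  · intro j _
    have : ((spec n).mapMatrix (shiftedMatrix μ (n + 1))) (Fin.last n) j.castSucc = 0 := by
      simp only [AlgHom.mapMatrix_apply, Matrix.map_apply, shiftedMatrix_apply, map_fallingPow,
        hlast, Fin.val_castSucc]
      rw [show μ.rowLen j + (n + 1 - 1 - j) = (μ.rowLen j + (n - 1 - j)) + 1 by omega,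
        fallingPow_zero_succ]
    rw [this]; ring

theorem colLen_bot_le (n : ℕ) : (⊥ : YoungDiagram).colLen 0 ≤ n :=
  colLen_zero_le_iff.2 (rowLen_bot n)

theorem existsUnique_shiftedSchur (μ : YoungDiagram) : ∃! s : ShiftedSym, IsShiftedSchur μ s := by
  choose f hf hsym hdeg using exists_schurPoly μ
  obtain ⟨F, hF⟩ := exists_shiftedSym_of_stable (μ.colLen 0) μ.card f (fun n _ => hsym n)
    (fun n hn => by
      have h1 := congrArg (spec n) (hf (n + 1))
      rw [map_mul, spec_shiftedMatrix_det hn, spec_shiftedMatrix_det (colLen_bot_le n),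
        ← hf n] at h1
      have hP : (∏ i : Fin n, (ell n i + 1)) ≠ 0 := by
        refine Finset.prod_ne_zero_iff.2 fun i _ h => ?_
        obtain ⟨x, hx⟩ := exists_eval_ell (0 : Fin n → ℂ)
        have := congrArg (eval x) h
        simp [hx] at this
      refine mul_right_cancel₀ (mul_ne_zero hP (shiftedMatrix_bot_det_ne_zero n)) ?_
      rw [h1]; ring)
    (fun n hn => (hdeg n).trans (sum_rowLen hn).le)
  refine ⟨F, fun n hn => by rw [hF n hn, hf n], fun G hG => ?_⟩
  refine shiftedSym_ext_of_large (μ.colLen 0) fun n hn => ?_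
  refine mul_right_cancel₀ (shiftedMatrix_bot_det_ne_zero n) ?_
  rw [hG n hn, hF n hn, hf n]

theorem isShiftedSchur_shiftedSchur (μ : YoungDiagram) : IsShiftedSchur μ (shiftedSchur μ) :=
  Classical.epsilon_spec (existsUnique_shiftedSchur μ).exists

/-! ### The generating series of the functions `h*_k` -/

/-- This is $u^{\downarrow(k+1)}=(u-k)\,u^{\downarrow k}$, rewritten in $t=1/u$. -/
theorem X_mul_invFalling (k : ℕ) :
    (1 - PowerSeries.C (k : ℂ) * PowerSeries.X) * invFalling (k + 1) =
      PowerSeries.X * invFalling k := by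
  have h0 : ∀ l : ℕ, PowerSeries.constantCoeff
      (1 - PowerSeries.C (l : ℂ) * PowerSeries.X : PowerSeries ℂ) ≠ 0 := by
    intro l; simp
  simp only [invFalling, Finset.prod_range_succ, PowerSeries.mul_inv_rev]
  have := PowerSeries.mul_inv_cancel _ (h0 k)
  linear_combination (PowerSeries.X ^ (k + 1) *
    (∏ l ∈ Finset.range k, (1 - PowerSeries.C (l : ℂ) * PowerSeries.X))⁻¹) * this

theorem coeff_invFalling_succ (k m : ℕ) :
    PowerSeries.coeff (m + 1) (invFalling (k + 1)) =
      PowerSeries.coeff m (invFalling k) + k * PowerSeries.coeff m (invFalling (k + 1)) := by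
  have := congrArg (PowerSeries.coeff (m + 1)) (X_mul_invFalling k)
  rw [sub_mul, one_mul, map_sub, mul_assoc, PowerSeries.coeff_C_mul, PowerSeries.coeff_succ_X_mul,
    PowerSeries.coeff_succ_X_mul] at this
  linear_combination this

theorem coeff_invFalling_of_lt {k m : ℕ} (h : m < k) :
    PowerSeries.coeff m (invFalling k) = 0 := by
  rw [invFalling, PowerSeries.coeff_X_pow_mul', if_neg (by omega)]

@[simp] theorem invFalling_zero : invFalling 0 = 1 := by simp [invFalling]

/-- The determinant is linear in the first column and the other columns are constant in $t$. -/
theorem coeff_det_updateCol {A : Type*} [CommRing A] {N : ℕ} (M : Matrix (Fin (N + 1)) (Fin (N + 1)) A)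
    (S : Fin (N + 1) → PowerSeries A) (m : ℕ) :
    PowerSeries.coeff m (((M.map PowerSeries.C).updateCol 0 S).det) =
      (M.updateCol 0 fun i => PowerSeries.coeff m (S i)).det := by
  rw [Matrix.det_succ_column_zero, Matrix.det_succ_column_zero, map_sum]
  refine Finset.sum_congr rfl fun i _ => ?_
  simp only [Matrix.updateCol_self]
  have h1 : (((M.map PowerSeries.C).updateCol 0 S).submatrix i.succAbove Fin.succ).det =
      PowerSeries.C (M.submatrix i.succAbove Fin.succ).det := by
    rw [RingHom.map_det]
    congr 1
  have h2 : (M.updateCol 0 fun i => PowerSeries.coeff m (S i)).submatrix i.succAbove Fin.succ =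
      M.submatrix i.succAbove Fin.succ := by
    ext1 a b
    simp
  have h3 : ((-1) ^ (i : ℕ) : PowerSeries A) = PowerSeries.C ((-1) ^ (i : ℕ)) := by simp
  rw [h1, h2, h3, PowerSeries.coeff_mul_C, PowerSeries.coeff_C_mul]

section

variable {A : Type*} [CommRing A] [Algebra ℂ A]

theorem coeff_expansion (g : ℕ → PowerSeries ℂ) (hg : g 0 = 1) (a : ℕ → A) (ha : a 0 = 1) (m : ℕ) :
    PowerSeries.coeff m (expansion g a) =
      ∑ k ∈ Finset.range (m + 1), PowerSeries.coeff m (g k) • a k := by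
  rw [expansion, map_add, PowerSeries.coeff_mk, Finset.range_eq_Ico,
    Finset.sum_eq_sum_Ico_succ_bot (by omega), hg, ha]
  congr 1
  rw [PowerSeries.coeff_one, PowerSeries.coeff_one]
  split_ifs <;> simp

/-- The series `∑_k l^{↓(k + N)} / u^{↓k}`. -/
def fallingSeries (l : A) (N : ℕ) : PowerSeries A :=
  PowerSeries.mk fun m => ∑ k ∈ Finset.range (m + 1),
    PowerSeries.coeff m (invFalling k) • fallingPow l (k + N)

/-- Put $a_k=l^{\downarrow(k+N)}/u^{\downarrow k}$ and $b_k=(u-k+1)a_k$. Then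
$(u+N+1-l)a_k=b_k-b_{k+1}$, and the sum telescopes to $b_0=(u+1)\,l^{\downarrow N}$. The proof
carries this out coefficient by coefficient. -/
theorem mul_fallingSeries (l : A) (N : ℕ) :
    (1 + PowerSeries.C ((N : A) + 1 - l) * PowerSeries.X) * fallingSeries l N =
      (1 + PowerSeries.X) * PowerSeries.C (fallingPow l N) := by
  ext m
  rw [add_mul, add_mul, one_mul, one_mul, map_add, map_add, mul_assoc, PowerSeries.coeff_C_mul]
  cases m with
  | zero => simp [fallingSeries]
  | succ m =>
    rw [PowerSeries.coeff_succ_X_mul, PowerSeries.coeff_succ_X_mul, PowerSeries.coeff_C,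
      if_neg (by omega), zero_add, fallingSeries, PowerSeries.coeff_mk, PowerSeries.coeff_mk,
      Finset.sum_range_succ' _ (m + 1)]
    have h1 : ∀ k ∈ Finset.range (m + 1),
        PowerSeries.coeff (m + 1) (invFalling (k + 1)) • fallingPow l (k + 1 + N) =
        PowerSeries.coeff m (invFalling k) • (fallingPow l (k + N) * (l - k - N)) +
        (k * PowerSeries.coeff m (invFalling (k + 1))) • fallingPow l (k + 1 + N) := by
      intro k _
      rw [coeff_invFalling_succ, add_smul, show k + 1 + N = k + N + 1 by omega, fallingPow_succ]
      push_cast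
      congr 3
      ring
    -- Reindexing by $k\mapsto k+1$: the new top term vanishes because $1/u^{\downarrow(m+1)}$ has
    -- order $m+1$ in $t$, and the missing term $k=0$, with weight $-1$, supplies the boundary term.
    have h2 : ∑ k ∈ Finset.range (m + 1),
        ((k : ℂ) * PowerSeries.coeff m (invFalling (k + 1))) • fallingPow l (k + 1 + N) =
        ∑ k ∈ Finset.range (m + 1),
          (((k : ℂ) - 1) * PowerSeries.coeff m (invFalling k)) • fallingPow l (k + N) +
          PowerSeries.coeff m (invFalling 0) • fallingPow l N := by
      have e1 := Finset.sum_range_succ (fun k =>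
        (((k : ℂ) - 1) * PowerSeries.coeff m (invFalling k)) • fallingPow l (k + N)) (m + 1)
      have e2 := Finset.sum_range_succ' (fun k =>
        (((k : ℂ) - 1) * PowerSeries.coeff m (invFalling k)) • fallingPow l (k + N)) (m + 1)
      rw [e1, coeff_invFalling_of_lt (Nat.lt_succ_self m)] at e2
      simp only [mul_zero, zero_smul, add_zero] at e2
      rw [e2]
      simp only [Nat.cast_add, Nat.cast_one, add_sub_cancel_right, Nat.cast_zero, zero_sub,
        neg_one_mul, zero_add, neg_smul]
      abel
    rw [Finset.sum_congr rfl h1, Finset.sum_add_distrib, h2]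
    have h3 : ∑ k ∈ Finset.range (m + 1),
        PowerSeries.coeff m (invFalling k) • (fallingPow l (k + N) * (l - k - N)) +
        ∑ k ∈ Finset.range (m + 1),
          (((k : ℂ) - 1) * PowerSeries.coeff m (invFalling k)) • fallingPow l (k + N) =
        -((N : A) + 1 - l) * ∑ k ∈ Finset.range (m + 1),
          PowerSeries.coeff m (invFalling k) • fallingPow l (k + N) := by
      rw [← Finset.sum_add_distrib, Finset.mul_sum]
      refine Finset.sum_congr rfl fun k _ => ?_
      simp only [Algebra.smul_def, map_mul, map_sub, map_natCast, map_one]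
      ring
    have h4 : PowerSeries.coeff (m + 1) (invFalling 0) • fallingPow l (0 + N) = 0 := by
      simp [PowerSeries.coeff_one]
    have h5 : PowerSeries.coeff m (invFalling 0) • fallingPow l N =
        PowerSeries.coeff m (PowerSeries.C (fallingPow l N)) := by
      rw [invFalling_zero, PowerSeries.coeff_one, PowerSeries.coeff_C]
      split_ifs <;> simp
    rw [h4, ← h5]
    linear_combination h3

/-- The columns of the Vandermonde determinant in falling powers satisfy a two-term recursion. -/
theorem mul_fallingPow_eq (l : A) (j N : ℕ) (hj : j < N) :
    (1 + PowerSeries.C ((N : A) + 1 - l) * PowerSeries.X) *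
        PowerSeries.C (fallingPow l (N - (j + 1))) =
      (1 + PowerSeries.C ((j : A) + 1 + 1) * PowerSeries.X) *
        PowerSeries.C (fallingPow l (N - (j + 1))) -
      PowerSeries.X * PowerSeries.C (fallingPow l (N - j)) := by
  obtain ⟨c, rfl⟩ := Nat.exists_eq_add_of_lt hj
  rw [show j + c + 1 - (j + 1) = c by omega, show j + c + 1 - j = c + 1 by omega, fallingPow_succ]
  simp only [map_add, map_sub, map_mul, map_one, Nat.cast_add, Nat.cast_one]
  ring

theorem det_fallingSeries {N : ℕ} (v : Fin (N + 1) → A) :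
    (((Matrix.of fun i j : Fin (N + 1) => fallingPow (v i) (N - j)).map
        PowerSeries.C).updateCol 0 fun i => fallingSeries (v i) N).det *
      ∏ i, (1 + PowerSeries.C ((N : A) + 1 - v i) * PowerSeries.X) =
    PowerSeries.C (Matrix.of fun i j : Fin (N + 1) => fallingPow (v i) (N - j)).det *
      ∏ j : Fin (N + 1), (1 + PowerSeries.C ((j : A) + 1) * PowerSeries.X) := by
  -- Once row $i$ is multiplied by its factor, every column combines at most two neighbouring
  -- columns of the falling-power matrix. `U`, upper bidiagonal, records these combinations.
  let U : Matrix (Fin (N + 1)) (Fin (N + 1)) (PowerSeries A) := Matrix.of fun j j' =>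
    (if j = j' then (1 + PowerSeries.C ((j' : A) + 1) * PowerSeries.X) else 0) +
      (if (j : ℕ) + 1 = j' then -PowerSeries.X else 0)
  have hU : U.det = ∏ j : Fin (N + 1), (1 + PowerSeries.C ((j : A) + 1) * PowerSeries.X) := by
    rw [Matrix.det_of_isUpperTriangular]
    · refine Finset.prod_congr rfl fun j _ => ?_
      simp [U]
    · intro j j' h
      have h' : j' < j := h
      simp only [U, Matrix.of_apply]
      rw [if_neg h'.ne', if_neg (by omega), add_zero]
  rw [mul_comm, ← Matrix.det_mul_column, ← hU, RingHom.map_det, ← Matrix.det_mul]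
  congr 1
  ext1 i j
  rw [Matrix.mul_apply]
  simp only [U, Matrix.of_apply, mul_add, Finset.sum_add_distrib, mul_ite, mul_zero,
    Finset.sum_ite_eq', Finset.mem_univ, if_true, RingHom.mapMatrix_apply, Matrix.map_apply]
  refine Fin.cases ?_ (fun j => ?_) j
  · rw [Matrix.updateCol_self, mul_fallingSeries, Finset.sum_eq_zero]
    · simp; ring
    · intro k _
      rw [if_neg (by simp)]
  · rw [Matrix.updateCol_ne (Fin.succ_ne_zero j), Finset.sum_eq_single j.castSucc]
    · simp only [Matrix.map_apply, Matrix.of_apply, Fin.val_succ, Fin.val_castSucc, if_true]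
      have := mul_fallingPow_eq (v i) j N j.2
      push_cast
      rw [this]; ring
    · intro k _ hk
      rw [if_neg]
      intro h
      exact hk (Fin.ext (by simpa using h))
    · simp

end

theorem mem_rowDiagram {k i j : ℕ} : (i, j) ∈ rowDiagram k ↔ i = 0 ∧ j < k := by
  rw [rowDiagram, YoungDiagram.mem_ofRowLens]
  simp only [List.length_singleton, Nat.lt_one_iff]
  constructor
  · rintro ⟨h1, h2⟩
    subst h1
    exact ⟨rfl, h2⟩
  · rintro ⟨rfl, h⟩
    exact ⟨rfl, h⟩

theorem rowLen_rowDiagram_zero (k : ℕ) : (rowDiagram k).rowLen 0 = k := by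
  have h : ∀ j, j < (rowDiagram k).rowLen 0 ↔ j < k := fun j => by
    rw [← YoungDiagram.mem_iff_lt_rowLen, mem_rowDiagram]; simp
  have h1 := h k
  have h2 := h ((rowDiagram k).rowLen 0)
  omega

theorem rowLen_rowDiagram_succ (k i : ℕ) : (rowDiagram k).rowLen (i + 1) = 0 := by
  by_contra h
  have := mem_rowDiagram.1 (YoungDiagram.mem_iff_lt_rowLen.2 (Nat.pos_of_ne_zero h))
  omega

theorem rowDiagram_zero : rowDiagram 0 = ⊥ := by
  ext ⟨i, j⟩
  rw [YoungDiagram.mem_cells, mem_rowDiagram]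
  simp

theorem shiftedSchur_bot : shiftedSchur ⊥ = 1 := by
  refine (existsUnique_shiftedSchur ⊥).unique (isShiftedSchur_shiftedSchur ⊥) fun n _ => ?_
  exact one_mul _

/-- The shifted symmetric polynomial in `n` variables of a shifted symmetric function. -/
def toVars (n : ℕ) : ShiftedSym →ₐ[ℂ] MvPolynomial (Fin n) ℂ :=
  (Pi.evalAlgHom ℂ (fun n : ℕ => MvPolynomial (Fin n) ℂ) n).comp ShiftedSym.val

theorem toVars_apply (n : ℕ) (f : ShiftedSym) : toVars n f = f.1 n := rfl

theorem shiftedMatrix_bot_succ (N : ℕ) : shiftedMatrix ⊥ (N + 1) =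
    Matrix.of fun i j : Fin (N + 1) => fallingPow (ell (N + 1) i) (N - j) := by
  ext1 i j
  simp [shiftedMatrix_apply]

theorem shiftedMatrix_row (k N : ℕ) : shiftedMatrix (rowDiagram k) (N + 1) =
    (shiftedMatrix ⊥ (N + 1)).updateCol 0 fun i => fallingPow (ell (N + 1) i) (k + N) := by
  ext1 i j
  refine Fin.cases ?_ (fun j => ?_) j
  · rw [Matrix.updateCol_self, shiftedMatrix_apply]
    simp [rowLen_rowDiagram_zero]
  · rw [Matrix.updateCol_ne (Fin.succ_ne_zero j), shiftedMatrix_apply, shiftedMatrix_apply]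
    simp [rowLen_rowDiagram_succ]

/-- This is $H^*(u)=\prod_i(u+i)/(u+i-x_i)$ in $N+1$ variables. Multiplied by the denominator
determinant, $h^*_k$ becomes a determinant whose first column alone depends on $k$. So the sum over
$k$ can be taken inside that column and evaluated by `det_fallingSeries`. -/
theorem map_HStar_mul (N : ℕ) :
    PowerSeries.map (toVars (N + 1) : ShiftedSym →+* MvPolynomial (Fin (N + 1)) ℂ) HStar *
      ∏ i : Fin (N + 1), (1 + PowerSeries.C (C ((i : ℂ) + 1) - X i) * PowerSeries.X) =
    ∏ i : Fin (N + 1), (1 + PowerSeries.C (C ((i : ℂ) + 1)) * PowerSeries.X) := by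
  have hV : (PowerSeries.C (shiftedMatrix ⊥ (N + 1)).det : PowerSeries _) ≠ 0 := by
    rw [Ne, map_eq_zero_iff _ PowerSeries.C_injective]
    exact shiftedMatrix_bot_det_ne_zero _
  refine mul_left_cancel₀ hV ?_
  have h1 : PowerSeries.C (shiftedMatrix ⊥ (N + 1)).det *
      PowerSeries.map (toVars (N + 1) : ShiftedSym →+* MvPolynomial (Fin (N + 1)) ℂ) HStar =
      (((shiftedMatrix ⊥ (N + 1)).map PowerSeries.C).updateCol 0
        fun i => fallingSeries (ell (N + 1) i) N).det := by
    ext1 m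
    rw [PowerSeries.coeff_C_mul, coeff_det_updateCol, PowerSeries.coeff_map, HStar,
      coeff_expansion _ invFalling_zero _ (by rw [shiftedH, rowDiagram_zero, shiftedSchur_bot]),
      map_sum, Finset.mul_sum, ← Matrix.cramer_apply]
    have h2 : (fun i => PowerSeries.coeff m (fallingSeries (ell (N + 1) i) N)) =
        ∑ k ∈ Finset.range (m + 1), algebraMap ℂ (MvPolynomial (Fin (N + 1)) ℂ)
          (PowerSeries.coeff m (invFalling k)) • fun i => fallingPow (ell (N + 1) i) (k + N) := by
      ext1 i
      rw [Finset.sum_apply]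
      simp [fallingSeries, Algebra.smul_def]
    rw [h2, map_sum, Finset.sum_apply]
    refine Finset.sum_congr rfl fun k _ => ?_
    rw [(Matrix.cramer _).map_smul, Pi.smul_apply, Matrix.cramer_apply, ← shiftedMatrix_row,
      ← isShiftedSchur_shiftedSchur (rowDiagram k) (N + 1)
        (colLen_zero_le_iff.2 (rowLen_rowDiagram_succ k N)), RingHom.coe_coe, map_smul (toVars (N + 1)),
      Algebra.smul_def, smul_eq_mul, toVars_apply, shiftedH]
    ring
  have h3 := det_fallingSeries (ell (N + 1))
  rw [← shiftedMatrix_bot_succ, ← h1, mul_assoc] at h3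
  convert h3 using 3
  · refine Finset.prod_congr rfl fun i _ => ?_
    congr 3
    simp [ell]
    ring
  · simp

/-! ### Generators of the algebra of shifted symmetric functions -/

/-- The coefficients are the elementary symmetric polynomials $e_k(a)$. -/
theorem sum_coeff_prod_one_add {R ι : Type*} [CommRing R] [DecidableEq ι] (s : Finset ι)
    (a : ι → R) (z : R) :
    ∑ k ∈ Finset.range (s.card + 1), z ^ (s.card - k) *
        PowerSeries.coeff k (∏ i ∈ s, (1 + PowerSeries.C (a i) * PowerSeries.X)) =
      ∏ i ∈ s, (a i + z) := by
  rw [Finset.prod_one_add, Finset.prod_add]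
  simp only [map_sum, Finset.mul_sum]
  rw [Finset.sum_comm]
  refine Finset.sum_congr rfl fun t ht => ?_
  have hc := Finset.card_le_card (Finset.mem_powerset.1 ht)
  simp only [Finset.prod_mul_distrib, Finset.prod_const, ← map_prod, PowerSeries.coeff_C_mul,
    PowerSeries.coeff_X_pow]
  rw [Finset.sum_eq_single t.card]
  · rw [if_pos rfl, Finset.card_sdiff_of_subset (Finset.mem_powerset.1 ht)]; ring
  · intro k _ hk
    rw [if_neg hk]; ring
  · intro h
    simp only [Finset.mem_range, not_lt] at h
    omega

/-- The coefficient of `t ^ k` has degree at most `k`, for all `k`. -/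
def DegLe {σ : Type*} (f : PowerSeries (MvPolynomial σ ℂ)) : Prop :=
  ∀ k, (PowerSeries.coeff k f).totalDegree ≤ k

section DegLe

variable {σ : Type*}

theorem DegLe.mul {f g : PowerSeries (MvPolynomial σ ℂ)} (hf : DegLe f) (hg : DegLe g) :
    DegLe (f * g) := by
  intro k
  rw [PowerSeries.coeff_mul]
  refine totalDegree_finsetSum_le fun p hp => ?_
  rw [← Finset.HasAntidiagonal.mem_antidiagonal.1 hp]
  exact (totalDegree_mul _ _).trans (add_le_add (hf _) (hg _))

theorem degLe_map_C (f : PowerSeries ℂ) :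
    DegLe (PowerSeries.map (C : ℂ →+* MvPolynomial σ ℂ) f) := by
  intro k
  rw [PowerSeries.coeff_map, totalDegree_C]
  exact Nat.zero_le _

theorem degLe_prod {ι : Type*} (s : Finset ι) (a : ι → MvPolynomial σ ℂ)
    (ha : ∀ i, (a i).totalDegree ≤ 1) :
    DegLe (∏ i ∈ s, (1 + PowerSeries.C (a i) * PowerSeries.X)) := by
  classical
  induction s using Finset.induction_on with
  | empty =>
    rw [Finset.prod_empty, ← map_one (PowerSeries.map (C : ℂ →+* MvPolynomial σ ℂ))]
    exact degLe_map_C 1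
  | insert i s hi ih =>
    rw [Finset.prod_insert hi]
    refine DegLe.mul (fun k => ?_) ih
    rcases k with _ | k
    · simp
    · rw [map_add, PowerSeries.coeff_C_mul, PowerSeries.coeff_one, if_neg (by omega), zero_add,
        PowerSeries.coeff_X]
      split_ifs with h
      · rw [mul_one]; exact (ha i).trans (by omega)
      · simp

end DegLe

/-- The linear form `i - n - x_i`. -/
def shiftForm (n : ℕ) (i : Fin n) : MvPolynomial (Fin n) ℂ := C ((i : ℂ) + 1) - X i - C (n : ℂ)

theorem constantCoeff_HStar : PowerSeries.constantCoeff HStar = 1 := by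
  simp [HStar, expansion]

/-- The coefficients of the inverse are found recursively as polynomials in those of `f`. -/
theorem exists_inverse_coeff_mem {A : Type*} [CommRing A] [Algebra ℂ A] (S : Subalgebra ℂ A)
    (f : PowerSeries A) (hf : PowerSeries.constantCoeff f = 1)
    (hS : ∀ m, PowerSeries.coeff m f ∈ S) :
    ∃ g : PowerSeries A, f * g = 1 ∧ ∀ m, PowerSeries.coeff m g ∈ S := by
  refine ⟨PowerSeries.invOfUnit f 1, PowerSeries.mul_invOfUnit _ _ (by rw [hf, Units.val_one]),
    fun m => ?_⟩
  induction m using Nat.strong_induction_on with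
  | _ m ih =>
    rw [PowerSeries.coeff_invOfUnit]
    split_ifs with h
    · rw [inv_one, Units.val_one]; exact S.one_mem
    · refine S.mul_mem (S.neg_mem ?_) (S.sum_mem fun p _ => ?_)
      · rw [inv_one, Units.val_one]; exact S.one_mem
      · split_ifs with h'
        · exact S.mul_mem (hS _) (ih _ h')
        · exact S.zero_mem

/-- The polynomial `∏ (1 + i t)`, `1 ≤ i ≤ n`, as a power series. -/
def risingSeries (n : ℕ) : PowerSeries ℂ :=
  ∏ i : Fin n, (1 + PowerSeries.C ((i : ℂ) + 1) * PowerSeries.X)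

theorem constantCoeff_risingSeries (n : ℕ) : PowerSeries.constantCoeff (risingSeries n) ≠ 0 := by
  simp [risingSeries]

/-- The reciprocal of $H^*$ is the useful series: in $M+1$ variables, after removal of a scalar
factor, its coefficients are the elementary symmetric polynomials in $i-x_i$. -/
theorem map_inverse_HStar_mul {G : PowerSeries ShiftedSym} (hG : HStar * G = 1) (M : ℕ) :
    PowerSeries.map (toVars (M + 1) : ShiftedSym →+* MvPolynomial (Fin (M + 1)) ℂ) G *
      PowerSeries.map (C : ℂ →+* MvPolynomial (Fin (M + 1)) ℂ) (risingSeries (M + 1)) =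
      ∏ i : Fin (M + 1), (1 + PowerSeries.C (C ((i : ℂ) + 1) - X i) * PowerSeries.X) := by
  have e1 := map_HStar_mul M
  have e2 := congrArg
    (PowerSeries.map (toVars (M + 1) : ShiftedSym →+* MvPolynomial (Fin (M + 1)) ℂ)) hG
  rw [map_mul, map_one] at e2
  have e3 : PowerSeries.map (C : ℂ →+* MvPolynomial (Fin (M + 1)) ℂ) (risingSeries (M + 1)) =
      ∏ i : Fin (M + 1), (1 + PowerSeries.C (C ((i : ℂ) + 1)) * PowerSeries.X) := by
    simp only [risingSeries, map_prod, map_add PowerSeries.C, map_add (PowerSeries.map _),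
      map_mul, map_one (PowerSeries.map _), PowerSeries.map_C, PowerSeries.map_X]
    simp only [← map_add]
  rw [e3, ← e1, ← mul_assoc, mul_comm (PowerSeries.map _ G), e2, one_mul]

theorem degLe_map_inverse_HStar {G : PowerSeries ShiftedSym} (hG : HStar * G = 1) (M : ℕ) :
    DegLe (PowerSeries.map (toVars (M + 1) : ShiftedSym →+* MvPolynomial (Fin (M + 1)) ℂ) G) := by
  have e := congrArg (fun s => s * PowerSeries.map (C : ℂ →+* MvPolynomial (Fin (M + 1)) ℂ)
    (risingSeries (M + 1))⁻¹) (map_inverse_HStar_mul hG M)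
  simp only [mul_assoc, ← map_mul] at e
  rw [PowerSeries.mul_inv_cancel _ (constantCoeff_risingSeries _), map_one, mul_one] at e
  rw [e]
  refine DegLe.mul (degLe_prod _ _ fun i => ?_) (degLe_map_C _)
  refine (totalDegree_sub _ _).trans (max_le ?_ ?_)
  · rw [totalDegree_C]; exact zero_le_one
  · rw [totalDegree_X]

/-- A subalgebra containing the coefficients of `H*(u)` contains a shifted symmetric function of
degree `n` whose restriction to `n` variables is the product of all `i - n - x_i`. -/
theorem exists_shiftForm_prod_mem (S : Subalgebra ℂ ShiftedSym)
    (hS : ∀ m, PowerSeries.coeff m HStar ∈ S) (n : ℕ) :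
    ∃ g ∈ S, (∀ m, (g.1 m).totalDegree ≤ n + 1) ∧ g.1 (n + 1) = ∏ i, shiftForm (n + 1) i := by
  obtain ⟨G, hG, hGS⟩ := exists_inverse_coeff_mem S HStar constantCoeff_HStar hS
  -- The scalar series is fixed at $n+1$ while the number of variables varies, so `T` is a series of
  -- shifted symmetric functions. Its coefficients are elementary symmetric polynomials only in
  -- $n+1$ variables, but the degree bound holds in all.
  obtain ⟨T, hT⟩ : ∃ T, T = G * PowerSeries.map (algebraMap ℂ ShiftedSym) (risingSeries (n + 1)) :=
    ⟨_, rfl⟩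
  have hTS : ∀ k, PowerSeries.coeff k T ∈ S := by
    intro k
    rw [hT, PowerSeries.coeff_mul]
    refine S.sum_mem fun p _ => S.mul_mem (hGS _) ?_
    rw [PowerSeries.coeff_map]
    exact S.algebraMap_mem _
  have hTmap : ∀ m, PowerSeries.map (toVars m : ShiftedSym →+* MvPolynomial (Fin m) ℂ) T =
      PowerSeries.map (toVars m : ShiftedSym →+* MvPolynomial (Fin m) ℂ) G *
        PowerSeries.map (C : ℂ →+* MvPolynomial (Fin m) ℂ) (risingSeries (n + 1)) := by
    intro m
    rw [hT, map_mul]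
    congr 1
  -- The weights are those of $\sum_k z^{n+1-k}e_k(a)=\prod_i(a_i+z)$ with $a_i=i-x_i$ and
  -- $z=-(n+1)$. For this $z$ the last factor is $-x_{n+1}$.
  obtain ⟨θ, hθ⟩ : ∃ θ : ShiftedSym, θ = ∑ k ∈ Finset.range (n + 1 + 1),
      algebraMap ℂ ShiftedSym ((-((n + 1 : ℕ) : ℂ)) ^ (n + 1 - k)) * PowerSeries.coeff k T :=
    ⟨_, rfl⟩
  have hθm : ∀ m, θ.1 m = ∑ k ∈ Finset.range (n + 1 + 1),
      C ((-((n + 1 : ℕ) : ℂ)) ^ (n + 1 - k)) *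
        PowerSeries.coeff k
          (PowerSeries.map (toVars m : ShiftedSym →+* MvPolynomial (Fin m) ℂ) T) := by
    intro m
    rw [← toVars_apply, hθ, map_sum]
    refine Finset.sum_congr rfl fun k _ => ?_
    rw [map_mul, AlgHom.commutes, PowerSeries.coeff_map, algebraMap_eq]
    rfl
  have hdeg : ∀ M, (θ.1 (M + 1)).totalDegree ≤ n + 1 := by
    intro M
    rw [hθm, hTmap]
    refine totalDegree_finsetSum_le fun k hk => ?_
    refine (totalDegree_mul _ _).trans ?_
    rw [totalDegree_C, zero_add]
    refine (((degLe_map_inverse_HStar hG M).mul (degLe_map_C _)) k).trans ?_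
    rw [Finset.mem_range] at hk
    omega
  refine ⟨θ, ?_, fun m => ?_, ?_⟩
  · rw [hθ]
    exact S.sum_mem fun k _ => S.mul_mem (S.algebraMap_mem _) (hTS k)
  · rcases m with _ | M
    · rw [← spec_shiftedSym]
      exact (totalDegree_spec_le _).trans (hdeg 0)
    · exact hdeg M
  · rw [hθm, hTmap, map_inverse_HStar_mul hG]
    have := sum_coeff_prod_one_add (Finset.univ : Finset (Fin (n + 1)))
      (fun i => (C ((i : ℂ) + 1) - X i : MvPolynomial (Fin (n + 1)) ℂ)) (C (-((n + 1 : ℕ) : ℂ)))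
    rw [Finset.card_univ, Fintype.card_fin] at this
    simp only [map_pow]
    rw [this]
    refine Finset.prod_congr rfl fun i _ => ?_
    rw [shiftForm, map_neg, ← sub_eq_add_neg]

theorem totalDegree_shiftForm {n : ℕ} (i : Fin n) : (shiftForm n i).totalDegree = 1 := by
  refine le_antisymm ?_ ?_
  · refine (totalDegree_sub _ _).trans (max_le ((totalDegree_sub _ _).trans (max_le ?_ ?_)) ?_)
    · rw [totalDegree_C]; exact zero_le_one
    · rw [totalDegree_X]
    · rw [totalDegree_C]; exact zero_le_one
  · by_contra hlt
    have h0 : (shiftForm n i).totalDegree = 0 := by omega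
    rw [totalDegree_eq_zero_iff_eq_C] at h0
    have h1 := congrArg (eval 0) h0
    have h2 := congrArg (eval 1) h0
    rw [eval_C] at h1 h2
    rw [← h1] at h2
    simp [shiftForm] at h2

theorem unshift_shiftForm {n : ℕ} (i : Fin n) :
    unshift n (shiftForm n i) = -(X i - C (-(n : ℂ))) := by
  simp only [shiftForm, unshift, map_sub, aeval_X, algHom_C, algebraMap_eq, map_neg]
  ring

theorem unshift_surjective (n : ℕ) : Function.Surjective (unshift n) := by
  intro r
  refine ⟨aeval (fun j : Fin n => X j - C ((j : ℂ) + 1)) r, MvPolynomial.funext fun x => ?_⟩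
  rw [unshift_eval, eval_aeval]
  simp

/-- A shifted symmetric polynomial that vanishes at `x_{n+1} = 0` is divisible by the product of
all `x_i - i + n + 1`. -/
theorem exists_eq_prod_shiftForm_mul {n : ℕ} {f : MvPolynomial (Fin (n + 1)) ℂ}
    (hf : IsShiftedSymmetric f) (h0 : spec n f = 0) :
    ∃ g, f = (∏ i, shiftForm (n + 1) i) * g ∧ IsShiftedSymmetric g := by
  have hq : ∀ i : Fin (n + 1), substVar i (C (-((n + 1 : ℕ) : ℂ))) (C (-((n + 1 : ℕ) : ℂ))) =
      C (-((n + 1 : ℕ) : ℂ)) := by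
    intro i; simp [substVar]
  have hne : ∀ i : Fin (n + 1), (X i - C (-((n + 1 : ℕ) : ℂ)) :
      MvPolynomial (Fin (n + 1)) ℂ) ≠ 0 := by
    intro i h
    have := congrArg (eval 0) h
    simp only [map_sub, eval_X, eval_C, Pi.zero_apply, map_zero] at this
    norm_cast at this
    simp at this
    norm_cast at this
  -- The condition $x_{n+1}=0$ says that the last shifted variable equals $-(n+1)$. Symmetry then
  -- carries the divisibility to all other variables.
  have hlast : X (Fin.last n) - C (-((n + 1 : ℕ) : ℂ)) ∣ unshift (n + 1) f := by
    rw [X_sub_dvd_iff (hq _)]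
    refine MvPolynomial.funext fun y => ?_
    rw [substVar, eval_aeval, unshift_eval]
    have := congrArg (eval fun j : Fin n => y j.castSucc + ((j : ℂ) + 1)) h0
    rw [eval_spec, map_zero] at this
    rw [map_zero, ← this]
    congr 2
    ext1 i
    refine Fin.lastCases ?_ (fun i => ?_) i
    · simp
    · simp
  have hdvd : ∀ i : Fin (n + 1), X i - C (-((n + 1 : ℕ) : ℂ)) ∣ unshift (n + 1) f := by
    intro i
    have := map_dvd (rename (R := ℂ) (Equiv.swap i (Fin.last n))) hlast
    rw [hf] at this
    simpa using this
  have hprod : ∏ i, unshift (n + 1) (shiftForm (n + 1) i) ∣ unshift (n + 1) f := by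
    refine prod_dvd_of_prime _ _ _ (fun i _ => ?_) (fun i _ j _ hij => ?_) (fun i _ => ?_)
    · rw [unshift_shiftForm]
      exact (prime_X_sub (hq i) (hne i)).neg
    · rw [unshift_shiftForm, unshift_shiftForm, neg_dvd, dvd_neg, X_sub_dvd_iff (hq i)]
      intro h
      apply hne j
      rw [← h]
      simp [substVar, Function.update_of_ne hij.symm]
    · rw [unshift_shiftForm, neg_dvd]
      exact hdvd i
  obtain ⟨r, hr⟩ := hprod
  obtain ⟨g, rfl⟩ := unshift_surjective (n + 1) r
  refine ⟨g, unshift_injective _ (by rw [hr, map_mul, map_prod]), fun σ => ?_⟩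
  have hP : ∏ i, unshift (n + 1) (shiftForm (n + 1) i) ≠ 0 := by
    refine Finset.prod_ne_zero_iff.2 fun i _ => ?_
    rw [unshift_shiftForm, neg_ne_zero]
    exact hne i
  have hσ : rename σ (∏ i, unshift (n + 1) (shiftForm (n + 1) i)) =
      ∏ i, unshift (n + 1) (shiftForm (n + 1) i) := by
    rw [map_prod, ← Equiv.prod_comp σ (fun i => unshift (n + 1) (shiftForm (n + 1) i))]
    refine Finset.prod_congr rfl fun i _ => ?_
    simp [unshift_shiftForm]
  have := hf σ
  rw [hr, map_mul, hσ] at this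
  exact mul_left_cancel₀ hP this

theorem isShiftedSymmetric_sub {n : ℕ} {f g : MvPolynomial (Fin n) ℂ}
    (hf : IsShiftedSymmetric f) (hg : IsShiftedSymmetric g) : IsShiftedSymmetric (f - g) := by
  rw [IsShiftedSymmetric, map_sub]
  exact IsSymmetric.sub hf hg

theorem totalDegree_prod_shiftForm_mul {n : ℕ} {g : MvPolynomial (Fin n) ℂ} (hg : g ≠ 0) :
    ((∏ i, shiftForm n i) * g).totalDegree = n + g.totalDegree := by
  have h1 := totalDegree_prod_eq Finset.univ (shiftForm n) fun i _ => totalDegree_shiftForm i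
  rw [totalDegree_mul_of_isDomain _ hg, h1, Finset.card_univ, Fintype.card_fin]
  refine Finset.prod_ne_zero_iff.2 fun i _ h => ?_
  have := totalDegree_shiftForm i
  simp [h] at this

/-- Double induction, as in the classical proof for elementary symmetric polynomials. A lift of the
specialization $x_{n+1}=0$ agrees with `f` up to a multiple of $\prod_i(i-n-1-x_i)$, and the
cofactor has smaller degree. The degree bound must hold in every number of variables for the final
comparison in `eq_top_of_coeff_HStar_mem`. -/
theorem exists_mem_eq_toVars (S : Subalgebra ℂ ShiftedSym)
    (hS : ∀ m, PowerSeries.coeff m HStar ∈ S) (n : ℕ) :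
    ∀ (D : ℕ) (f : MvPolynomial (Fin n) ℂ), IsShiftedSymmetric f → f.totalDegree ≤ D →
      ∃ g ∈ S, (∀ m, (g.1 m).totalDegree ≤ D) ∧ g.1 n = f := by
  induction n with
  | zero =>
    intro D f _ _
    refine ⟨algebraMap ℂ ShiftedSym (f.coeff 0), S.algebraMap_mem _, fun m => ?_, ?_⟩
    · change (C (f.coeff 0) : MvPolynomial (Fin m) ℂ).totalDegree ≤ D
      simp
    · change C (f.coeff 0) = f
      exact (eq_C_of_isEmpty f).symm
  | succ n ihn =>
    intro D
    induction D using Nat.strong_induction_on with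
    | _ D ihD =>
    intro f hf hD
    obtain ⟨g, hgS, hgD, hg⟩ := ihn D (spec n f) hf.spec ((totalDegree_spec_le f).trans hD)
    obtain ⟨r, hr, hrs⟩ := exists_eq_prod_shiftForm_mul
      (isShiftedSymmetric_sub hf (g.2.1 (n + 1))) (by rw [map_sub, spec_shiftedSym, hg, sub_self])
    by_cases hr0 : r = 0
    · rw [hr0, mul_zero, sub_eq_zero] at hr
      exact ⟨g, hgS, hgD, hr.symm⟩
    · have hd : n + 1 + r.totalDegree ≤ D := by
        rw [← totalDegree_prod_shiftForm_mul hr0, ← hr]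
        exact (totalDegree_sub _ _).trans (max_le hD (hgD _))
      obtain ⟨g', hgS', hgD', hg'⟩ := ihD (D - (n + 1)) (by omega) r hrs (by omega)
      obtain ⟨t, htS, htD, ht⟩ := exists_shiftForm_prod_mem S hS n
      refine ⟨g + t * g', S.add_mem hgS (S.mul_mem htS hgS'), fun m => ?_, ?_⟩
      · refine (totalDegree_add _ _).trans (max_le (hgD m) ?_)
        refine (totalDegree_mul _ _).trans ?_
        have h1 := htD m
        have h2 := hgD' m
        omega
      · change g.1 (n + 1) + t.1 (n + 1) * g'.1 (n + 1) = f
        rw [ht, hg', ← hr]; ring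

/-- A shifted symmetric function of degree at most `D` that vanishes in `D` variables is zero. -/
theorem shiftedSym_eq_zero {f : ShiftedSym} {D : ℕ} (hD : ∀ m, (f.1 m).totalDegree ≤ D)
    (h : f.1 D = 0) : f = 0 := by
  refine shiftedSym_ext_of_large D fun n hn => ?_
  change f.1 n = 0
  induction n, hn using Nat.le_induction with
  | base => exact h
  | succ n hn ih =>
    obtain ⟨r, hr, -⟩ := exists_eq_prod_shiftForm_mul (f.2.1 (n + 1))
      (by rw [spec_shiftedSym, ih])
    by_cases hr0 : r = 0
    · rw [hr, hr0, mul_zero]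
    · have := hD (n + 1)
      rw [hr, totalDegree_prod_shiftForm_mul hr0] at this
      omega

/-- A function of degree at most $D$ is determined by its restriction to $D$ variables, and that
restriction lifts to an element of `S` of degree at most $D$. -/
theorem eq_top_of_coeff_HStar_mem (S : Subalgebra ℂ ShiftedSym)
    (hS : ∀ m, PowerSeries.coeff m HStar ∈ S) : S = ⊤ := by
  refine eq_top_iff.2 fun f _ => ?_
  obtain ⟨D, hD⟩ := f.2.2.2
  obtain ⟨g, hgS, hgD, hg⟩ := exists_mem_eq_toVars S hS D D (f.1 D) (f.2.1 D) (hD D)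
  have : f - g = 0 := shiftedSym_eq_zero (D := D)
    (fun m => (totalDegree_sub _ _).trans (max_le (hD m) (hgD m)))
    (by change f.1 D - g.1 D = 0; rw [hg, sub_self])
  rwa [sub_eq_zero.1 this]

/-! ### The generating series of the supersymmetric functions `h_k` -/

/-- Evaluation of supersymmetric functions at `x_1, …, x_m; y_1, …, y_n`. -/
def superEval {m n : ℕ} (x : Fin m → ℂ) (y : Fin n → ℂ) : SuperSym →ₐ[ℂ] ℂ :=
  (aeval (Sum.elim x y)).comp (((Pi.evalAlgHom ℂ (fun n => MvPolynomial (Fin m ⊕ Fin n) ℂ) n).comp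
    (Pi.evalAlgHom ℂ (fun m => ∀ n, MvPolynomial (Fin m ⊕ Fin n) ℂ) m)).comp SuperSym.val)

theorem superEval_apply {m n : ℕ} (x : Fin m → ℂ) (y : Fin n → ℂ) (F : SuperSym) :
    superEval x y F = eval (Sum.elim x y) (F.1 m n) := rfl

theorem superEval_superPowerSum {m n : ℕ} (x : Fin m → ℂ) (y : Fin n → ℂ) (r : ℕ) :
    superEval x y (superPowerSum r) = ∑ i, x i ^ (r + 1) + (-1) ^ r * ∑ j, y j ^ (r + 1) := by
  simp [superEval_apply, superPowerSum]

theorem derivative_prod_one_add {ι : Type*} (s : Finset ι) (a : ι → ℂ) :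
    PowerSeries.derivative ℂ (∏ i ∈ s, (1 + PowerSeries.C (a i) * PowerSeries.X)) =
      (∏ i ∈ s, (1 + PowerSeries.C (a i) * PowerSeries.X)) *
        ∑ i ∈ s, PowerSeries.C (a i) * (1 + PowerSeries.C (a i) * PowerSeries.X)⁻¹ := by
  classical
  induction s using Finset.induction_on with
  | empty => simp
  | insert i s hi ih =>
    have h0 : PowerSeries.constantCoeff (1 + PowerSeries.C (a i) * PowerSeries.X) ≠ 0 := by simp
    have h1 := PowerSeries.mul_inv_cancel _ h0
    have h2 : PowerSeries.derivative ℂ (1 + PowerSeries.C (a i) * PowerSeries.X) =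
        PowerSeries.C (a i) := by
      simp [Derivation.leibniz]
    rw [Finset.prod_insert hi, Finset.sum_insert hi, Derivation.leibniz, ih, h2, smul_eq_mul,
      smul_eq_mul]
    linear_combination (-(PowerSeries.C (a i) *
      ∏ i ∈ s, (1 + PowerSeries.C (a i) * PowerSeries.X))) * h1

theorem coeff_C_mul_inv (a : ℂ) (r : ℕ) :
    PowerSeries.coeff r (PowerSeries.C a * (1 + PowerSeries.C a * PowerSeries.X)⁻¹) =
      (-1) ^ r * a ^ (r + 1) := by
  have h0 : PowerSeries.constantCoeff (1 + PowerSeries.C a * PowerSeries.X) ≠ 0 := by simp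
  have : (1 + PowerSeries.C a * PowerSeries.X)⁻¹ = PowerSeries.mk fun r => (-a) ^ r := by
    rw [PowerSeries.inv_eq_iff_mul_eq_one h0]
    ext r
    rw [mul_add, mul_one, mul_left_comm, map_add, PowerSeries.coeff_C_mul, PowerSeries.coeff_one]
    cases r with
    | zero => simp
    | succ r => simp; ring
  rw [this, PowerSeries.coeff_C_mul, PowerSeries.coeff_mk, neg_pow]
  ring

/-- Both sides have constant term $1$ and the same logarithmic derivative: that of the exponential
is $\sum_r \mathbf p_{r+1}t^r$, a sum of geometric series in the variables. -/
theorem map_hSeries_mul {m n : ℕ} (x : Fin m → ℂ) (y : Fin n → ℂ) :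
    PowerSeries.map (superEval x y : SuperSym →+* ℂ) hSeries *
      ∏ i, (1 + PowerSeries.C (-x i) * PowerSeries.X) =
    ∏ j, (1 + PowerSeries.C (y j) * PowerSeries.X) := by
  obtain ⟨L, hL⟩ : ∃ L : PowerSeries ℂ, L = PowerSeries.X * PowerSeries.mk fun r =>
      ((r + 1 : ℂ)⁻¹) * superEval x y (superPowerSum r) := ⟨_, rfl⟩
  have hL0 : PowerSeries.HasSubst L := by
    refine PowerSeries.HasSubst.of_constantCoeff_zero' ?_
    rw [hL]; simp
  obtain ⟨E, hE⟩ : ∃ E : PowerSeries ℂ, E = (PowerSeries.exp ℂ).subst L := ⟨_, rfl⟩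
  have hmap : PowerSeries.map (superEval x y : SuperSym →+* ℂ) hSeries = E := by
    rw [hE, hSeries]
    have h1 := PowerSeries.map_subst (h := (superEval x y : SuperSym →+* ℂ))
      (a := PowerSeries.X * PowerSeries.mk fun r => ((r + 1 : ℂ)⁻¹) • superPowerSum r)
      (PowerSeries.HasSubst.of_constantCoeff_zero' (by simp)) (PowerSeries.exp SuperSym)
    refine h1.trans ?_
    rw [PowerSeries.map_exp]
    congr 1
    change PowerSeries.map _ _ = _
    rw [map_mul, hL, PowerSeries.map_X]
    congr 1
    ext1 r
    rw [PowerSeries.coeff_map, PowerSeries.coeff_mk, PowerSeries.coeff_mk, RingHom.coe_coe,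
      map_smul, smul_eq_mul]
  have hE0 : PowerSeries.constantCoeff E = 1 := by
    rw [← hmap, ← PowerSeries.coeff_zero_eq_constantCoeff_apply, hmap, hE,
      PowerSeries.coeff_subst' hL0, finsum_eq_single _ 0]
    · simp
    · intro d hd
      have : PowerSeries.coeff 0 (L ^ d) = 0 := by
        rw [PowerSeries.coeff_zero_eq_constantCoeff_apply, map_pow, hL]
        simp [hd]
      rw [this, smul_zero]
  have hdE : PowerSeries.derivative ℂ E = E * PowerSeries.derivative ℂ L := by
    rw [hE, PowerSeries.derivative_subst hL0, PowerSeries.derivative_exp]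
  have hdL : PowerSeries.derivative ℂ L =
      -∑ i, PowerSeries.C (-x i) * (1 + PowerSeries.C (-x i) * PowerSeries.X)⁻¹ +
      ∑ j, PowerSeries.C (y j) * (1 + PowerSeries.C (y j) * PowerSeries.X)⁻¹ := by
    ext r
    rw [PowerSeries.coeff_derivative, hL, PowerSeries.coeff_succ_X_mul, PowerSeries.coeff_mk,
      map_add, map_neg, map_sum, map_sum]
    simp only [coeff_C_mul_inv, superEval_superPowerSum]
    have h0 : (r + 1 : ℂ) ≠ 0 := by exact_mod_cast Nat.succ_ne_zero r
    have h1 : ∀ i, (-1 : ℂ) ^ r * (-x i) ^ (r + 1) = -(x i ^ (r + 1)) := by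
      intro i
      rw [neg_pow (x i), ← mul_assoc, ← pow_add, Odd.neg_one_pow ⟨r, by ring⟩]
      ring
    simp only [h1, Finset.sum_neg_distrib, neg_neg, Finset.mul_sum]
    field_simp
  have hB0 : PowerSeries.constantCoeff (∏ j, (1 + PowerSeries.C (y j) * PowerSeries.X)) ≠ 0 := by
    simp
  have hBB := PowerSeries.mul_inv_cancel _ hB0
  have hdA := derivative_prod_one_add Finset.univ fun i => -x i
  have hdB := derivative_prod_one_add Finset.univ y
  have hA1 : PowerSeries.constantCoeff
      (∏ i, (1 + PowerSeries.C (-x i) * PowerSeries.X)) = 1 := by simp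
  have hB1 : PowerSeries.constantCoeff
      (∏ j, (1 + PowerSeries.C (y j) * PowerSeries.X)) = 1 := by simp
  rw [hmap]
  generalize (∏ i, (1 + PowerSeries.C (-x i) * PowerSeries.X)) = A at *
  generalize (∏ j, (1 + PowerSeries.C (y j) * PowerSeries.X)) = B at *
  generalize ∑ i, PowerSeries.C (-x i) * (1 + PowerSeries.C (-x i) * PowerSeries.X)⁻¹ = a at *
  generalize ∑ j, PowerSeries.C (y j) * (1 + PowerSeries.C (y j) * PowerSeries.X)⁻¹ = b at *
  -- A series with zero derivative is constant, and the constant is read off at $t=0$.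
  have key : E * A * B⁻¹ = 1 := by
    refine PowerSeries.derivative.ext ?_ ?_
    · rw [Derivation.leibniz, Derivation.leibniz, PowerSeries.derivative_inv', hdE, hdL, hdA, hdB,
        PowerSeries.derivative_one]
      simp only [smul_eq_mul]
      linear_combination (-(E * A * B⁻¹ * b)) * hBB
    · rw [map_mul, map_mul, hE0, hA1, PowerSeries.constantCoeff_inv, hB1]
      simp
  calc E * A = E * A * B⁻¹ * B := by rw [mul_assoc (E * A), mul_comm B⁻¹, hBB, mul_one]
    _ = B := by rw [key, one_mul]

/-! ### The shift of the variable `u` -/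

/-- Replacing $u$ by $u+r$ replaces $t$ by $t/(1+rt)$. -/
theorem expansion_invShiftPow (r : ℂ) (h : PowerSeries ℂ) (h1 : PowerSeries.coeff 0 h = 1) :
    expansion (invShiftPow r) (fun k => PowerSeries.coeff k h) =
      h.subst (PowerSeries.X * (1 + PowerSeries.C r * PowerSeries.X)⁻¹ : PowerSeries ℂ) := by
  have hs : PowerSeries.HasSubst
      (PowerSeries.X * (1 + PowerSeries.C r * PowerSeries.X)⁻¹ : PowerSeries ℂ) :=
    PowerSeries.HasSubst.of_constantCoeff_zero' (by simp)
  have hpow : ∀ k, (PowerSeries.X * (1 + PowerSeries.C r * PowerSeries.X)⁻¹ : PowerSeries ℂ) ^ k =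
      invShiftPow r k := by
    intro k
    have h0 : PowerSeries.constantCoeff (1 + PowerSeries.C r * PowerSeries.X) ≠ 0 := by simp
    rw [invShiftPow, mul_pow]
    congr 1
    rw [eq_comm, PowerSeries.inv_eq_iff_mul_eq_one (by simp), ← mul_pow,
      PowerSeries.inv_mul_cancel _ h0, one_pow]
  ext m
  rw [coeff_expansion _ (by simp [invShiftPow]) _ h1, PowerSeries.coeff_subst' hs,
    finsum_eq_sum_of_support_subset (s := Finset.range (m + 1))]
  · refine Finset.sum_congr rfl fun k _ => ?_
    rw [hpow, smul_eq_mul, smul_eq_mul, mul_comm]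
  · intro k hk
    by_contra h
    apply hk
    simp only [Finset.coe_range, Set.mem_Iio, not_lt] at h
    change _ • _ = _
    rw [hpow, invShiftPow, PowerSeries.coeff_X_pow_mul', if_neg (by omega), smul_zero]

theorem map_expansion {A B : Type*} [CommRing A] [Algebra ℂ A] [CommRing B] [Algebra ℂ B]
    (f : A →ₐ[ℂ] B) (g : ℕ → PowerSeries ℂ) (a : ℕ → A) :
    PowerSeries.map (f : A →+* B) (expansion g a) = expansion g fun k => f (a k) := by
  rw [expansion, expansion, map_add, map_one]
  congr 1
  ext1 m
  simp

theorem map_HShift_mul {d : ℕ} (x y : Fin d → ℂ) (r : ℂ) :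
    PowerSeries.map (superEval x y : SuperSym →+* ℂ) (HShift r) *
      ∏ i, (1 + PowerSeries.C (r - x i) * PowerSeries.X) =
    ∏ j, (1 + PowerSeries.C (r + y j) * PowerSeries.X) := by
  have hh := map_hSeries_mul x y
  have h1 : PowerSeries.coeff 0 (PowerSeries.map (superEval x y : SuperSym →+* ℂ) hSeries) = 1 := by
    have := congrArg PowerSeries.constantCoeff hh
    rw [PowerSeries.coeff_zero_eq_constantCoeff_apply]
    simpa using this
  have h2 : PowerSeries.map (superEval x y : SuperSym →+* ℂ) (HShift r) =
      expansion (invShiftPow r) fun k =>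
        PowerSeries.coeff k (PowerSeries.map (superEval x y : SuperSym →+* ℂ) hSeries) := by
    rw [HShift, map_expansion]
    rfl
  rw [expansion_invShiftPow r _ h1] at h2
  obtain ⟨s, hs⟩ : ∃ s : PowerSeries ℂ,
      s = PowerSeries.X * (1 + PowerSeries.C r * PowerSeries.X)⁻¹ := ⟨_, rfl⟩
  have hs0 : PowerSeries.HasSubst s := PowerSeries.HasSubst.of_constantCoeff_zero' (by simp [hs])
  have hss : (1 + PowerSeries.C r * PowerSeries.X) * s = PowerSeries.X := by
    rw [hs, mul_left_comm, PowerSeries.mul_inv_cancel _ (by simp), mul_one]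
  have hlin : ∀ c : ℂ, (1 + PowerSeries.C r * PowerSeries.X) *
      ((1 + PowerSeries.C c * PowerSeries.X : PowerSeries ℂ).subst s : PowerSeries ℂ) =
      1 + PowerSeries.C (r + c) * PowerSeries.X := by
    intro c
    have e : ((1 + PowerSeries.C c * PowerSeries.X : PowerSeries ℂ).subst s : PowerSeries ℂ) =
        1 + PowerSeries.C c * s := by
      rw [← PowerSeries.coe_substAlgHom hs0, map_add, map_one, map_mul,
        PowerSeries.substAlgHom_X]
      congr 2
      exact AlgHom.commutes (PowerSeries.substAlgHom hs0) c
    rw [e, map_add]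
    linear_combination PowerSeries.C c * hss
  -- Each linear factor needs one factor $1+rt$ to clear its denominator. There are equally many
  -- $x$'s and $y$'s, so the same power serves both sides.
  have hprod : ∀ c : Fin d → ℂ, (1 + PowerSeries.C r * PowerSeries.X) ^ d *
      ((∏ i, (1 + PowerSeries.C (c i) * PowerSeries.X) : PowerSeries ℂ).subst s : PowerSeries ℂ) =
      ∏ i, (1 + PowerSeries.C (r + c i) * PowerSeries.X) := by
    intro c
    rw [← PowerSeries.coe_substAlgHom hs0, map_prod]
    have hc : (1 + PowerSeries.C r * PowerSeries.X : PowerSeries ℂ) ^ d =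
        ∏ _i : Fin d, (1 + PowerSeries.C r * PowerSeries.X) := by simp
    rw [hc, ← Finset.prod_mul_distrib]
    refine Finset.prod_congr rfl fun i _ => ?_
    rw [PowerSeries.coe_substAlgHom]
    exact hlin (c i)
  have h3 := congrArg (fun f => (PowerSeries.subst s f : PowerSeries ℂ)) hh
  simp only [PowerSeries.subst_mul hs0] at h3
  rw [h2, ← hs, ← hprod y, ← h3, ← mul_assoc, mul_comm (_ ^ d), mul_assoc]
  congr 1
  rw [hprod]
  simp only [sub_eq_add_neg]

/-! ### Frobenius coordinates -/

/-- The diagonal boxes form an initial segment of the diagonal. -/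
theorem lt_depth_iff {ν : YoungDiagram} {i : ℕ} : i < depth ν ↔ (i, i) ∈ ν := by
  have hlow : ∀ i j, i ≤ j → (j, j) ∈ ν → (i, i) ∈ ν := fun i j h hj => ν.up_left_mem h h hj
  have hcard : depth ν = (ν.cells.filter fun c => c.1 = c.2).card := rfl
  constructor
  · intro h
    by_contra hi
    have : (ν.cells.filter fun c => c.1 = c.2).card ≤ (Finset.range i).card := by
      refine Finset.card_le_card_of_injOn Prod.fst ?_ ?_
      · rintro ⟨a, b⟩ hc
        simp only [Finset.coe_filter, Set.mem_ofPred_eq] at hc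
        obtain ⟨hc, rfl⟩ := hc
        simp only [Finset.coe_range, Set.mem_Iio]
        by_contra hlt
        exact hi (hlow i a (not_lt.1 hlt) hc)
      · rintro ⟨a, b⟩ hc ⟨a', b'⟩ hc' e
        simp only [Finset.coe_filter, Set.mem_ofPred_eq] at hc hc'
        obtain ⟨-, rfl⟩ := hc
        obtain ⟨-, rfl⟩ := hc'
        simp only at e
        rw [e]
    rw [Finset.card_range] at this
    omega
  · intro h
    have : (Finset.range (i + 1)).card ≤ (ν.cells.filter fun c => c.1 = c.2).card := by
      refine Finset.card_le_card_of_injOn (fun a => (a, a)) ?_ ?_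
      · intro a ha
        simp only [Finset.coe_range, Set.mem_Iio] at ha
        simp only [Finset.coe_filter, Set.mem_ofPred_eq, and_true]
        exact hlow a i (by omega) h
      · intro a _ b _ e
        exact (Prod.ext_iff.1 e).1
    rw [Finset.card_range] at this
    omega

theorem depth_le_colLen (ν : YoungDiagram) : depth ν ≤ ν.colLen 0 := by
  by_contra h
  have h1 := lt_depth_iff.1 (not_le.1 h)
  have h2 := YoungDiagram.mem_iff_lt_colLen.1 (ν.up_left_mem le_rfl (Nat.zero_le _) h1)
  omega

/-- The numbers `q_i + 1` and `i - ν_i`, `i > d`, together are `1, …, n`. -/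
theorem prod_frobenius {ν : YoungDiagram} {n : ℕ} (hn : ν.colLen 0 ≤ n) {M : Type*}
    [CommMonoid M] (f : ℤ → M) :
    (∏ i : Fin (depth ν), f (ν.colLen i - i)) *
      ∏ i ∈ Finset.Ico (depth ν) n, f (i + 1 - ν.rowLen i) =
    ∏ i ∈ Finset.range n, f (i + 1) := by
  have hd : depth ν ≤ n := (depth_le_colLen ν).trans hn
  have hrow : ∀ i j, j < ν.rowLen i ↔ i < ν.colLen j := fun i j => by
    rw [← YoungDiagram.mem_iff_lt_rowLen, YoungDiagram.mem_iff_lt_colLen]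
  have hdr : ∀ i, i < depth ν ↔ i < ν.rowLen i := fun i => by
    rw [lt_depth_iff, YoungDiagram.mem_iff_lt_rowLen]
  have hcol : ∀ j, ν.colLen j ≤ n := fun j => (ν.colLen_anti 0 j (Nat.zero_le j)).trans hn
  have hanti : ∀ i j, i ≤ j → ν.rowLen j ≤ ν.rowLen i := fun i j h => ν.rowLen_anti i j h
  have hanti' : ∀ i j, i ≤ j → ν.colLen j ≤ ν.colLen i := fun i j h => ν.colLen_anti i j h
  have hr0 : ∀ i, depth ν ≤ i → ν.rowLen i ≤ i := fun i h => by
    have := hdr i; omega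
  rw [Fin.prod_univ_eq_prod_range (fun i => f ((ν.colLen i : ℤ) - i)) (depth ν)]
  -- Both families are merged into one map on $\{0,\dots,n-1\}$. Being injective with values in
  -- $\{1,\dots,n\}$, it is a bijection onto that set.
  let g : ℕ → ℤ := fun i => if i < depth ν then (ν.colLen i : ℤ) - i else i + 1 - ν.rowLen i
  have h1 : ∏ i ∈ Finset.range (depth ν), f ((ν.colLen i : ℤ) - i) =
      ∏ i ∈ Finset.range (depth ν), f (g i) := by
    refine Finset.prod_congr rfl fun i hi => ?_
    rw [Finset.mem_range] at hi
    simp only [g, if_pos hi]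
  have h2 : ∏ i ∈ Finset.Ico (depth ν) n, f (i + 1 - ν.rowLen i) =
      ∏ i ∈ Finset.Ico (depth ν) n, f (g i) := by
    refine Finset.prod_congr rfl fun i hi => ?_
    rw [Finset.mem_Ico] at hi
    simp only [g, if_neg (not_lt.2 hi.1)]
  rw [h1, h2, Finset.prod_range_mul_prod_Ico _ hd]
  have hgpos : ∀ i < n, 1 ≤ g i ∧ g i ≤ n := by
    intro i hi
    simp only [g]
    split_ifs with h
    · have a1 := (hrow i i).1 ((hdr i).1 h)
      have a2 := hcol i
      omega
    · have a1 := hr0 i (not_lt.1 h)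
      omega
  -- Equality would mean $\nu'_i+\nu_j=i+j+1$ in zero-based indices. That sum is at least $i+j+2$ if
  -- the box $(j,i)$ lies in $\nu$, and at most $i+j$ otherwise.
  have hmix : ∀ i j, i < depth ν → ¬ j < depth ν →
      (ν.colLen i : ℤ) - i ≠ j + 1 - ν.rowLen j := by
    intro i j _ _ e
    have := hrow j i
    omega
  have hginj : ∀ i < n, ∀ j < n, g i = g j → i = j := by
    intro i _ j _ e
    simp only [g] at e
    split_ifs at e with h h' h'
    · rcases lt_trichotomy i j with hij | hij | hij
      · have := hanti' i j hij.le; omega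
      · exact hij
      · have := hanti' j i hij.le; omega
    · exact absurd e (hmix i j h h')
    · exact absurd e.symm (hmix j i h' h)
    · rcases lt_trichotomy i j with hij | hij | hij
      · have := hanti i j hij.le; omega
      · exact hij
      · have := hanti j i hij.le; omega
  have himage : (Finset.range n).image g = (Finset.range n).image fun i : ℕ => (i : ℤ) + 1 := by
    have hsub : (Finset.range n).image g ⊆ (Finset.range n).image fun i : ℕ => (i : ℤ) + 1 := by
      intro z hz
      obtain ⟨i, hi, rfl⟩ := Finset.mem_image.1 hz
      rw [Finset.mem_range] at hi
      have := hgpos i hi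
      exact Finset.mem_image.2 ⟨(g i - 1).toNat, Finset.mem_range.2 (by omega), by omega⟩
    refine Finset.eq_of_subset_of_card_le hsub ?_
    rw [Finset.card_image_of_injOn (s := Finset.range n) (f := g)]
    · exact Finset.card_image_le
    · intro i hi j hj e
      exact hginj i (by simpa using hi) j (by simpa using hj) e
  rw [← Finset.prod_image (s := Finset.range n) (g := g) (f := f), himage, Finset.prod_image]
  · intro i _ j _ e
    simpa using e
  · intro i hi j hj e
    exact hginj i (by simpa using hi) j (by simpa using hj) e

/-- The diagram with the given Frobenius coordinates. -/
theorem exists_diagram_of_frobenius {d : ℕ} (p q : Fin d → ℕ) (hp : StrictAnti p)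
    (hq : StrictAnti q) : ∃ ν : YoungDiagram, depth ν = d ∧
      ∀ i : Fin d, ν.rowLen i = p i + i + 1 ∧ ν.colLen i = q i + i + 1 := by
  -- Strict decrease of the coordinates is weak decrease of the row or column lengths.
  have key : ∀ {r : Fin d → ℕ}, StrictAnti r → ∀ i j (hi : i < d) (hj : j < d), i ≤ j →
      r ⟨j, hj⟩ + j ≤ r ⟨i, hi⟩ + i := by
    intro r hr i j hi hj hij
    induction j, hij using Nat.le_induction with
    | base => exact le_rfl
    | succ j hij ih =>
      have h1 := ih (by omega)
      have h2 : r ⟨j + 1, hj⟩ < r ⟨j, by omega⟩ := hr (by simp [Fin.lt_def])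
      omega
  -- The union of the diagonal hooks: arms, containing the diagonal boxes, then legs.
  let P : ℕ × ℕ → Prop := fun c =>
    (∃ h : c.1 < d, c.1 ≤ c.2 ∧ c.2 ≤ p ⟨c.1, h⟩ + c.1) ∨
      ∃ h : c.2 < d, c.2 < c.1 ∧ c.1 ≤ q ⟨c.2, h⟩ + c.2
  have hrow : ∀ i (hi : i < d) j, P (i, j) ↔ j < p ⟨i, hi⟩ + i + 1 := by
    intro i hi j
    simp only [P]
    constructor
    · rintro (⟨_, h1, h2⟩ | ⟨_, h1, h2⟩) <;> omega
    · intro h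
      by_cases hij : i ≤ j
      · exact Or.inl ⟨hi, hij, by omega⟩
      · refine Or.inr ⟨by omega, by omega, ?_⟩
        have := key hq j i (by omega) hi (by omega)
        omega
  have hcol : ∀ j (hj : j < d) i, P (i, j) ↔ i < q ⟨j, hj⟩ + j + 1 := by
    intro j hj i
    simp only [P]
    constructor
    · rintro (⟨_, h1, h2⟩ | ⟨_, h1, h2⟩) <;> omega
    · intro h
      by_cases hij : j < i
      · exact Or.inr ⟨hj, hij, by omega⟩
      · refine Or.inl ⟨by omega, by omega, ?_⟩
        have := key hp i j (by omega) hj (by omega)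
        omega
  have hmin : ∀ i j, P (i, j) → i < d ∨ j < d := by
    rintro i j (⟨h, _⟩ | ⟨h, _⟩)
    · exact Or.inl h
    · exact Or.inr h
  have hlow : ∀ i j i' j', i' ≤ i → j' ≤ j → P (i, j) → P (i', j') := by
    have hl1 : ∀ i j i', i' ≤ i → P (i, j) → P (i', j) := by
      intro i j i' hi h
      by_cases hj : j < d
      · rw [hcol j hj] at h ⊢; omega
      · have hid : i < d := (hmin i j h).resolve_right hj
        rw [hrow i hid] at h
        rw [hrow i' (by omega)]
        have := key hp i' i (by omega) hid hi
        omega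
    have hl2 : ∀ i j j', j' ≤ j → P (i, j) → P (i, j') := by
      intro i j j' hj h
      by_cases hi : i < d
      · rw [hrow i hi] at h ⊢; omega
      · have hjd : j < d := (hmin i j h).resolve_left hi
        rw [hcol j hjd] at h
        rw [hcol j' (by omega)]
        have := key hq j' j (by omega) hjd hj
        omega
    exact fun i j i' j' hi hj h => hl1 _ _ _ hi (hl2 _ _ _ hj h)
  let B := d + ∑ i, p i + ∑ i, q i
  have hB : ∀ i j, P (i, j) → i < B ∧ j < B := by
    have hpB : ∀ i : Fin d, p i ≤ ∑ i, p i := fun i =>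
      Finset.single_le_sum (f := p) (fun _ _ => Nat.zero_le _) (Finset.mem_univ i)
    have hqB : ∀ i : Fin d, q i ≤ ∑ i, q i := fun i =>
      Finset.single_le_sum (f := q) (fun _ _ => Nat.zero_le _) (Finset.mem_univ i)
    rintro i j (⟨h, h1, h2⟩ | ⟨h, h1, h2⟩) <;> simp only [B] at h h1 h2 ⊢
    · have := hpB ⟨i, h⟩; omega
    · have := hqB ⟨j, h⟩; omega
  classical
  let ν : YoungDiagram :=
    { cells := (Finset.range B ×ˢ Finset.range B).filter P
      isLowerSet := by
        rintro ⟨i, j⟩ ⟨i', j'⟩ hle h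
        simp only [Finset.coe_filter, Set.mem_ofPred_eq] at h ⊢
        have h' := hlow _ _ _ _ hle.1 hle.2 h.2
        exact ⟨by simpa using hB _ _ h', h'⟩ }
  have hmem : ∀ i j, (i, j) ∈ ν ↔ P (i, j) := by
    intro i j
    change (i, j) ∈ (Finset.range B ×ˢ Finset.range B).filter P ↔ _
    rw [Finset.mem_filter, Finset.mem_product, Finset.mem_range, Finset.mem_range]
    exact ⟨fun h => h.2, fun h => ⟨hB _ _ h, h⟩⟩
  refine ⟨ν, ?_, fun i => ⟨?_, ?_⟩⟩
  · have h : ∀ i, i < depth ν ↔ i < d := by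
      intro i
      rw [lt_depth_iff, hmem]
      constructor
      · intro h
        exact (hmin i i h).elim id id
      · intro h
        rw [hrow i h]; omega
    have h1 := h d
    have h2 := h (depth ν)
    omega
  · have h : ∀ j, j < ν.rowLen i ↔ j < p i + i + 1 := fun j => by
      rw [← YoungDiagram.mem_iff_lt_rowLen, hmem, hrow i i.2]
    have h1 := h (p i + i + 1)
    have h2 := h (ν.rowLen i)
    omega
  · have h : ∀ j, j < ν.colLen i ↔ j < q i + i + 1 := fun j => by
      rw [← YoungDiagram.mem_iff_lt_colLen, hmem, hcol i i.2]
    have h1 := h (q i + i + 1)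
    have h2 := h (ν.colLen i)
    omega

/-! ### A supersymmetric function is determined by its values at Frobenius coordinates -/

/-- Evaluation at the modified Frobenius coordinates of a diagram. -/
def frobeniusEval (ν : YoungDiagram) : SuperSym →ₐ[ℂ] ℂ :=
  superEval (fun i : Fin (depth ν) => (ν.rowLen i : ℂ) - ((i : ℂ) + 1) + 1 / 2)
    (fun i : Fin (depth ν) => (ν.colLen i : ℂ) - ((i : ℂ) + 1) + 1 / 2)

theorem frobeniusEval_apply (ν : YoungDiagram) (F : SuperSym) :
    frobeniusEval ν F = evalFrobenius F ν := rfl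

theorem exists_perm_strictAnti {d : ℕ} {p : Fin d → ℕ} (hp : Function.Injective p) :
    ∃ σ : Equiv.Perm (Fin d), StrictAnti (p ∘ σ) := by
  have h : StrictMono (p ∘ Tuple.sort p) :=
    (Tuple.monotone_sort p).strictMono_of_injective (hp.comp (Tuple.sort p).injective)
  exact ⟨Fin.revPerm.trans (Tuple.sort p), fun i j hij => h (Fin.rev_lt_rev.2 hij)⟩

/-- Separate symmetry allows the coordinates to be sorted, after which they are those of a diagram.
It has at least `m` boxes because its first row is longer than `m`; this uses `0 < d`. -/
theorem eval_superSym_eq_zero {m d : ℕ} (hd : 0 < d) {F : SuperSym}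
    (hF : ∀ ν : YoungDiagram, m ≤ ν.card → evalFrobenius F ν = 0) {p q : Fin d → ℕ}
    (hp : Function.Injective p) (hq : Function.Injective q) (hm : ∀ i, m ≤ p i) :
    eval (Sum.elim (fun i => (p i : ℂ) + 1 / 2) fun i => (q i : ℂ) + 1 / 2) (F.1 d d) = 0 := by
  obtain ⟨σ, hσ⟩ := exists_perm_strictAnti hp
  obtain ⟨τ, hτ⟩ := exists_perm_strictAnti hq
  obtain ⟨ν, hν, h⟩ := exists_diagram_of_frobenius _ _ hσ hτ
  subst hν
  have hcard : m ≤ ν.card := by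
    have h1 := (h ⟨0, hd⟩).1
    have h2 : ν.rowLen 0 ≤ ν.card := by
      rw [YoungDiagram.rowLen_eq_card]
      exact Finset.card_filter_le _ _
    have h3 := hm (σ ⟨0, hd⟩)
    simp only [Function.comp] at h1
    omega
  have h0 := hF ν hcard
  rw [evalFrobenius] at h0
  have hsymm := ((F.2.1 (depth ν) (depth ν)).1 σ τ)
  rw [← hsymm, eval_rename, ← h0]
  congr 2
  ext1 i
  rcases i with i | i
  · have := (h i).1
    simp only [Function.comp, Sum.map_inl, Sum.elim_inl] at this ⊢
    rw [this]; push_cast; ring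
  · have := (h i).2
    simp only [Function.comp, Sum.map_inr, Sum.elim_inr] at this ⊢
    rw [this]; push_cast; ring

theorem superSym_diag_eq_zero {m d : ℕ} (hd : 0 < d) {F : SuperSym}
    (hF : ∀ ν : YoungDiagram, m ≤ ν.card → evalFrobenius F ν = 0) : F.1 d d = 0 := by
  -- Each variable gets its own residue class modulo $d$ within the $x$'s or the $y$'s, so
  -- coordinates chosen independently are automatically distinct. A polynomial vanishing on a
  -- product of infinite sets is zero.
  let s : Fin d ⊕ Fin d → Set ℂ := fun v =>
    Set.range fun k : ℕ => ((m + (Sum.elim id id v : Fin d).val + d * k : ℕ) : ℂ)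
      + 1 / 2
  have hs : ∀ v, (s v).Infinite := by
    intro v
    refine Set.infinite_range_of_injective fun k l h => ?_
    have h' := Nat.cast_injective (add_right_cancel h)
    exact Nat.eq_of_mul_eq_mul_left hd (by omega)
  refine funext_set s hs fun x hx => ?_
  rw [map_zero]
  choose k hk using fun v => hx v trivial
  have hinj : ∀ l : Fin d → ℕ, Function.Injective fun i : Fin d => m + (i : ℕ) + d * l i := by
    intro l i j h
    have h1 : (i : ℕ) + d * l i = j + d * l j := by
      simp only at h; omega
    have h2 := congrArg (· % d) h1
    simp only [Nat.add_mul_mod_self_left, Nat.mod_eq_of_lt i.2, Nat.mod_eq_of_lt j.2] at h2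
    exact Fin.ext h2
  have := eval_superSym_eq_zero hd hF (hinj fun i => k (Sum.inl i)) (hinj fun i => k (Sum.inr i))
    (fun i => by omega)
  rw [← this]
  congr 2
  ext1 v
  rw [← hk v]
  rcases v with i | i <;> simp

theorem superSym_eq_zero {m : ℕ} {F : SuperSym}
    (hF : ∀ ν : YoungDiagram, m ≤ ν.card → evalFrobenius F ν = 0) : F = 0 := by
  have hX : ∀ k a b, F.1 (a + k) b = 0 → F.1 a b = 0 := by
    intro k
    induction k with
    | zero => exact fun a b h => h
    | succ k ih =>
      intro a b h
      refine ih a b ?_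
      rw [← F.2.2.1 (a + k) b]
      exact (congrArg _ h).trans (map_zero _)
  have hY : ∀ k a b, F.1 a (b + k) = 0 → F.1 a b = 0 := by
    intro k
    induction k with
    | zero => exact fun a b h => h
    | succ k ih =>
      intro a b h
      refine ih a b ?_
      rw [← F.2.2.2.1 a (b + k)]
      exact (congrArg _ h).trans (map_zero _)
  refine Subtype.ext (funext fun a => funext fun b => ?_)
  -- Both numbers of variables are raised to $a+b+1$, which is positive even for $a=b=0$.
  refine hX (b + 1) a b (hY (a + 1) _ b ?_)
  rw [show b + (a + 1) = a + (b + 1) by omega]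
  exact superSym_diag_eq_zero (by omega) hF

theorem superSym_ext {m : ℕ} {F G : SuperSym}
    (h : ∀ ν : YoungDiagram, m ≤ ν.card → evalFrobenius F ν = evalFrobenius G ν) : F = G := by
  refine sub_eq_zero.1 (superSym_eq_zero (m := m) fun ν hν => ?_)
  rw [← frobeniusEval_apply, map_sub, frobeniusEval_apply, frobeniusEval_apply, h ν hν, sub_self]

/-! ### The value of a shifted symmetric function at a diagram -/

/-- The value `f(ν_1, ν_2, …)` of a shifted symmetric function. -/
def diagramEval (ν : YoungDiagram) : ShiftedSym →ₐ[ℂ] ℂ :=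
  (aeval fun i : Fin (ν.colLen 0) => (ν.rowLen i : ℂ)).comp (toVars (ν.colLen 0))

theorem diagramEval_eq {ν : YoungDiagram} {n : ℕ} (hn : ν.colLen 0 ≤ n) (f : ShiftedSym) :
    diagramEval ν f = eval (fun i : Fin n => (ν.rowLen i : ℂ)) (f.1 n) := by
  induction n, hn using Nat.le_induction with
  | base => rfl
  | succ n hn ih =>
    rw [ih, ← spec_shiftedSym, eval_spec]
    congr 2
    ext1 i
    refine Fin.lastCases ?_ (fun i => ?_) i
    · simp [rowLen_eq_zero hn]
    · simp

/-- The linear series `1 + z t`. -/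
def linSeries (z : ℤ) : PowerSeries ℂ := 1 + PowerSeries.C (z : ℂ) * PowerSeries.X

theorem prod_linSeries_ne_zero {ι : Type*} (s : Finset ι) (z : ι → ℤ) :
    ∏ i ∈ s, linSeries (z i) ≠ 0 := by
  intro h
  have := congrArg PowerSeries.constantCoeff h
  simp [linSeries] at this

theorem map_diagramEval_HStar {ν : YoungDiagram} {N : ℕ} (hN : ν.colLen 0 ≤ N + 1) :
    PowerSeries.map (diagramEval ν : ShiftedSym →+* ℂ) HStar *
      ∏ i ∈ Finset.range (N + 1), linSeries (i + 1 - ν.rowLen i) =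
    ∏ i ∈ Finset.range (N + 1), linSeries (i + 1) := by
  have h := congrArg (PowerSeries.map (eval fun i : Fin (N + 1) => (ν.rowLen i : ℂ)))
    (map_HStar_mul N)
  have h1 : PowerSeries.map (eval fun i : Fin (N + 1) => (ν.rowLen i : ℂ))
      (PowerSeries.map (toVars (N + 1) : ShiftedSym →+* MvPolynomial (Fin (N + 1)) ℂ) HStar) =
      PowerSeries.map (diagramEval ν : ShiftedSym →+* ℂ) HStar := by
    ext m
    rw [PowerSeries.coeff_map, PowerSeries.coeff_map, PowerSeries.coeff_map, RingHom.coe_coe,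
      RingHom.coe_coe, diagramEval_eq hN]
    rfl
  rw [map_mul, h1] at h
  rw [← Fin.prod_univ_eq_prod_range (fun i => linSeries (i + 1 - ν.rowLen i)),
    ← Fin.prod_univ_eq_prod_range (fun i => linSeries (i + 1))]
  simpa [linSeries] using h

/-- The halves combine: $\frac12-(p_i+\frac12)=-p_i$ and $\frac12+(q_i+\frac12)=q_i+1$. This is why
the argument is shifted by $\frac12$. -/
theorem map_frobeniusEval_HShift (ν : YoungDiagram) :
    PowerSeries.map (frobeniusEval ν : SuperSym →+* ℂ) (HShift (1 / 2)) *
      ∏ i ∈ Finset.range (depth ν), linSeries (i + 1 - ν.rowLen i) =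
    ∏ i : Fin (depth ν), linSeries (ν.colLen i - i) := by
  have h := map_HShift_mul (fun i : Fin (depth ν) => (ν.rowLen i : ℂ) - ((i : ℂ) + 1) + 1 / 2)
    (fun i : Fin (depth ν) => (ν.colLen i : ℂ) - ((i : ℂ) + 1) + 1 / 2) (1 / 2)
  rw [← Fin.prod_univ_eq_prod_range (fun i => linSeries (i + 1 - ν.rowLen i))]
  have h1 : ∏ i : Fin (depth ν), linSeries (i + 1 - ν.rowLen i) = ∏ i : Fin (depth ν),
      (1 + PowerSeries.C ((1 / 2 : ℂ) - ((ν.rowLen i : ℂ) - ((i : ℂ) + 1) + 1 / 2)) *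
        PowerSeries.X) := by
    refine Finset.prod_congr rfl fun i _ => ?_
    rw [linSeries]
    congr 3
    push_cast; ring
  have h2 : ∏ i : Fin (depth ν), linSeries (ν.colLen i - i) = ∏ i : Fin (depth ν),
      (1 + PowerSeries.C ((1 / 2 : ℂ) + ((ν.colLen i : ℂ) - ((i : ℂ) + 1) + 1 / 2)) *
        PowerSeries.X) := by
    refine Finset.prod_congr rfl fun i _ => ?_
    rw [linSeries]
    congr 3
    push_cast; ring
  rw [h1, h2]
  exact h

/-- The first $d$ denominators $u+i-\nu_i=u-p_i$ occur on both sides. By `prod_frobenius` the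
remaining ones cancel against $\prod_i(u+i)$ and leave $\prod_i(u+q_i+1)$. -/
theorem map_frobeniusEval_HShift_eq (ν : YoungDiagram) :
    PowerSeries.map (frobeniusEval ν : SuperSym →+* ℂ) (HShift (1 / 2)) =
      PowerSeries.map (diagramEval ν : ShiftedSym →+* ℂ) HStar := by
  have hn : ν.colLen 0 ≤ ν.colLen 0 + 1 := Nat.le_succ _
  refine mul_right_cancel₀ (prod_linSeries_ne_zero (Finset.range (ν.colLen 0 + 1))
    fun i => i + 1 - ν.rowLen i) ?_
  rw [map_diagramEval_HStar hn, ← prod_frobenius hn linSeries, ← map_frobeniusEval_HShift,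
    ← Finset.prod_range_mul_prod_Ico _ ((depth_le_colLen ν).trans hn), mul_assoc]

/-! ### The homomorphism from shifted symmetric to supersymmetric functions -/

/-- The functions with this property form a subalgebra, and it contains the coefficients of
$H^*(u)$. -/
theorem exists_evalFrobenius_eq (f : ShiftedSym) :
    ∃ F : SuperSym, ∀ ν, evalFrobenius F ν = diagramEval ν f := by
  let T : Subalgebra ℂ ShiftedSym :=
    { carrier := {f | ∃ F : SuperSym, ∀ ν, frobeniusEval ν F = diagramEval ν f}
      mul_mem' := by
        rintro f g ⟨F, hF⟩ ⟨G, hG⟩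
        exact ⟨F * G, fun ν => by rw [map_mul, map_mul, hF, hG]⟩
      add_mem' := by
        rintro f g ⟨F, hF⟩ ⟨G, hG⟩
        exact ⟨F + G, fun ν => by rw [map_add, map_add, hF, hG]⟩
      algebraMap_mem' := fun r =>
        ⟨algebraMap ℂ SuperSym r, fun ν => by rw [AlgHom.commutes, AlgHom.commutes]⟩ }
  have hT : T = ⊤ := eq_top_of_coeff_HStar_mem T fun m =>
    ⟨PowerSeries.coeff m (HShift (1 / 2)), fun ν => by
      have := congrArg (PowerSeries.coeff m) (map_frobeniusEval_HShift_eq ν)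
      rwa [PowerSeries.coeff_map, PowerSeries.coeff_map] at this⟩
  have hf : f ∈ T := by rw [hT]; trivial
  exact hf

theorem algHom_ext_of_mapsHStar {φ ψ : ShiftedSym →ₐ[ℂ] SuperSym} (hφ : MapsHStar φ)
    (hψ : MapsHStar ψ) : φ = ψ := by
  have h : AlgHom.equalizer φ ψ = ⊤ := eq_top_of_coeff_HStar_mem _ fun m => by
    have := congrArg (PowerSeries.coeff m) (hφ.trans hψ.symm)
    rwa [PowerSeries.coeff_map, PowerSeries.coeff_map] at this
  ext1 f
  have hf : f ∈ AlgHom.equalizer φ ψ := by rw [h]; trivial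
  exact hf

/-- The function chosen for each `f` is determined by its values at diagrams, where both evaluations
are homomorphisms. So any choice is automatically a homomorphism. -/
theorem exists_mapsHStar : ∃ φ : ShiftedSym →ₐ[ℂ] SuperSym, MapsHStar φ ∧
    ∀ f ν, evalFrobenius (φ f) ν = diagramEval ν f := by
  choose Φ hΦ using exists_evalFrobenius_eq
  have hext : ∀ {F G : SuperSym}, (∀ ν, frobeniusEval ν F = frobeniusEval ν G) → F = G :=
    fun h => superSym_ext (m := 0) fun ν _ => h ν
  have hΦ' : ∀ f ν, frobeniusEval ν (Φ f) = diagramEval ν f := hΦ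
  let φ : ShiftedSym →ₐ[ℂ] SuperSym :=
    { toFun := Φ
      map_one' := hext fun ν => by rw [hΦ', map_one, map_one]
      map_mul' := fun f g => hext fun ν => by rw [hΦ', map_mul, map_mul, hΦ', hΦ']
      map_zero' := hext fun ν => by rw [hΦ', map_zero, map_zero]
      map_add' := fun f g => hext fun ν => by rw [hΦ', map_add, map_add, hΦ', hΦ']
      commutes' := fun r => hext fun ν => by rw [hΦ', AlgHom.commutes, AlgHom.commutes] }
  refine ⟨φ, ?_, hΦ⟩
  ext1 m
  refine hext fun ν => ?_
  have := congrArg (PowerSeries.coeff m) (map_frobeniusEval_HShift_eq ν)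
  rw [PowerSeries.coeff_map, PowerSeries.coeff_map] at this
  rw [PowerSeries.coeff_map]
  exact (hΦ' _ ν).trans this.symm

theorem existsUnique_mapsHStar : ∃! φ : ShiftedSym →ₐ[ℂ] SuperSym, MapsHStar φ := by
  obtain ⟨φ, hφ, -⟩ := exists_mapsHStar
  exact ⟨φ, hφ, fun ψ hψ => algHom_ext_of_mapsHStar hψ hφ⟩

theorem evalFrobenius_Fs (μ ν : YoungDiagram) :
    evalFrobenius (Fs μ) ν = diagramEval ν (shiftedSchur μ) := by
  obtain ⟨φ, hφ, h⟩ := exists_mapsHStar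
  have hphi : MapsHStar phi := Classical.epsilon_spec existsUnique_mapsHStar.exists
  rw [Fs, algHom_ext_of_mapsHStar hphi hφ, h]

/-! ### Young diagrams and their row lengths -/

theorem le_iff_rowLen_le {μ ν : YoungDiagram} : μ ≤ ν ↔ ∀ i, μ.rowLen i ≤ ν.rowLen i := by
  constructor
  · intro h i
    by_contra hlt
    have := YoungDiagram.mem_iff_lt_rowLen.1
      (h (YoungDiagram.mem_iff_lt_rowLen.2 (not_le.1 hlt)))
    omega
  · rintro h ⟨i, j⟩ hc
    have h1 := YoungDiagram.mem_iff_lt_rowLen.1 hc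
    exact YoungDiagram.mem_iff_lt_rowLen.2 (h1.trans_le (h i))

theorem ext_rowLen {μ ν : YoungDiagram} (h : ∀ i, μ.rowLen i = ν.rowLen i) : μ = ν :=
  le_antisymm (le_iff_rowLen_le.2 fun i => (h i).le) (le_iff_rowLen_le.2 fun i => (h i).ge)

theorem exists_diagram_of_rowLen {r : ℕ → ℕ} (hr : Antitone r) {N : ℕ} (hN : r N = 0) :
    ∃ ν : YoungDiagram, ∀ i, ν.rowLen i = r i := by
  let ν : YoungDiagram :=
    { cells := (Finset.range N ×ˢ Finset.range (r 0)).filter fun c => c.2 < r c.1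
      isLowerSet := by
        rintro ⟨i, j⟩ ⟨i', j'⟩ hle h
        obtain ⟨hi, hj⟩ : i' ≤ i ∧ j' ≤ j := hle
        simp only [Finset.coe_filter, Set.mem_ofPred_eq, Finset.mem_product,
          Finset.mem_range] at h ⊢
        have := hr hi
        omega }
  have hmem : ∀ i j, (i, j) ∈ ν ↔ j < r i := by
    intro i j
    change (i, j) ∈ (Finset.range N ×ˢ Finset.range (r 0)).filter (fun c => c.2 < r c.1) ↔ _
    rw [Finset.mem_filter, Finset.mem_product, Finset.mem_range, Finset.mem_range]
    refine ⟨fun h => h.2, fun h => ⟨⟨?_, h.trans_le (hr (Nat.zero_le i))⟩, h⟩⟩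
    by_contra hi
    have h1 : r i ≤ r N := hr (not_lt.1 hi)
    have h2 : j < r i := h
    omega
  refine ⟨ν, fun i => ?_⟩
  have h : ∀ j, j < ν.rowLen i ↔ j < r i := fun j => by
    rw [← YoungDiagram.mem_iff_lt_rowLen, hmem]
  have h1 := h (r i)
  have h2 := h (ν.rowLen i)
  omega

theorem exists_removeBox {ν : YoungDiagram} {i : ℕ} (h : ν.rowLen (i + 1) < ν.rowLen i) :
    ∃ ν' : YoungDiagram, ∀ k, ν'.rowLen k = Function.update ν.rowLen i (ν.rowLen i - 1) k := by
  refine exists_diagram_of_rowLen (N := ν.colLen 0) (antitone_nat_of_succ_le fun k => ?_) ?_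
  · have h1 := ν.rowLen_anti k (k + 1) (Nat.le_succ k)
    by_cases hk : k = i
    · subst hk
      rw [Function.update_self, Function.update_of_ne (by omega)]
      omega
    · rw [Function.update_of_ne hk]
      by_cases hk' : k + 1 = i
      · subst hk'
        rw [Function.update_self]
        omega
      · rwa [Function.update_of_ne hk']
  · have h1 := rowLen_eq_zero (le_refl (ν.colLen 0))
    by_cases hk : ν.colLen 0 = i
    · rw [hk, Function.update_self, ← hk, h1]
    · rw [Function.update_of_ne hk, h1]

open Classical in
/-- The diagram obtained by removing the last box of a row, if this is possible. -/
def removeBox (ν : YoungDiagram) (i : ℕ) : YoungDiagram :=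
  if h : ν.rowLen (i + 1) < ν.rowLen i then (exists_removeBox h).choose else ν

theorem rowLen_removeBox {ν : YoungDiagram} {i : ℕ} (h : ν.rowLen (i + 1) < ν.rowLen i) (k : ℕ) :
    (removeBox ν i).rowLen k = Function.update ν.rowLen i (ν.rowLen i - 1) k := by
  rw [removeBox, dif_pos h]
  exact (exists_removeBox h).choose_spec k

theorem removeBox_lt {ν : YoungDiagram} {i : ℕ} (h : ν.rowLen (i + 1) < ν.rowLen i) :
    removeBox ν i < ν := by
  refine lt_of_le_of_ne (le_iff_rowLen_le.2 fun k => ?_) fun e => ?_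
  · rw [rowLen_removeBox h]
    by_cases hk : k = i
    · subst hk; rw [Function.update_self]; omega
    · rw [Function.update_of_ne hk]
  · have := rowLen_removeBox h i
    rw [e, Function.update_self] at this
    omega

theorem card_strictMono : StrictMono YoungDiagram.card := fun _ _ h =>
  Finset.card_lt_card (YoungDiagram.cells_ssubset_iff.2 h)

theorem colLen_mono {μ ν : YoungDiagram} (h : μ ≤ ν) : μ.colLen 0 ≤ ν.colLen 0 := by
  rw [colLen_zero_le_iff]
  have := le_iff_rowLen_le.1 h (ν.colLen 0)
  rw [rowLen_eq_zero le_rfl] at this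
  omega

/-- Row lengths only decrease and their sum drops by at most one, so exactly one row loses exactly
one box. -/
theorem exists_eq_removeBox {ν ν' : YoungDiagram} (h : ν' < ν) (hc : ν.card ≤ ν'.card + 1) :
    ∃ i, ν.rowLen (i + 1) < ν.rowLen i ∧ ν' = removeBox ν i := by
  have hle := le_iff_rowLen_le.1 h.le
  obtain ⟨i, hi⟩ : ∃ i, ν'.rowLen i < ν.rowLen i := by
    by_contra hcon
    push Not at hcon
    exact h.ne (ext_rowLen fun i => le_antisymm (hle i) (hcon i))
  have hN : ν.colLen 0 ≤ ν.colLen 0 := le_rfl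
  have hiN : i < ν.colLen 0 := by
    by_contra hcon
    rw [rowLen_eq_zero (not_lt.1 hcon)] at hi
    omega
  have hs := sum_rowLen hN
  have hs' := sum_rowLen (colLen_mono h.le)
  rw [Fin.sum_univ_eq_sum_range (fun k => ν.rowLen k)] at hs
  rw [Fin.sum_univ_eq_sum_range (fun k => ν'.rowLen k)] at hs'
  rw [← Finset.add_sum_erase _ _ (Finset.mem_range.2 hiN)] at hs hs'
  have hother : ∀ k, k ≠ i → ν'.rowLen k = ν.rowLen k := by
    intro k hk
    by_contra hne
    have hlt : ν'.rowLen k < ν.rowLen k := lt_of_le_of_ne (hle k) hne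
    have hkN : k < ν.colLen 0 := by
      by_contra hcon
      rw [rowLen_eq_zero (not_lt.1 hcon)] at hlt
      omega
    have := Finset.sum_lt_sum (s := (Finset.range (ν.colLen 0)).erase i) (f := ν'.rowLen)
      (g := ν.rowLen) (fun k _ => hle k)
      ⟨k, Finset.mem_erase.2 ⟨hk, Finset.mem_range.2 hkN⟩, hlt⟩
    omega
  have hi' : ν'.rowLen i = ν.rowLen i - 1 := by
    have := Finset.sum_le_sum (s := (Finset.range (ν.colLen 0)).erase i) (f := ν'.rowLen)
      (g := ν.rowLen) (fun k _ => hle k)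
    omega
  have hrem : ν.rowLen (i + 1) < ν.rowLen i := by
    rw [← hother (i + 1) (by omega)]
    exact (ν'.rowLen_anti i (i + 1) (Nat.le_succ i)).trans_lt hi
  refine ⟨i, hrem, ext_rowLen fun k => ?_⟩
  rw [rowLen_removeBox hrem]
  by_cases hk : k = i
  · subst hk; rw [Function.update_self, hi']
  · rw [Function.update_of_ne hk, hother k hk]

/-! ### Counting chains of diagrams -/

/-- The chains of length `k` from `μ` to `ν`. -/
def chainSet (μ ν : YoungDiagram) (k : ℕ) : Set (LTSeries YoungDiagram) :=
  {c | c.head = μ ∧ c.last = ν ∧ c.length = k}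

theorem card_add_length_le (c : LTSeries YoungDiagram) :
    c.head.card + c.length ≤ c.last.card :=
  (c.map YoungDiagram.card card_strictMono).head_add_length_le_nat

theorem relDim_eq_ncard (μ ν : YoungDiagram) :
    relDim μ ν = (chainSet μ ν (ν.card - μ.card)).ncard := by
  rw [relDim]
  split_ifs with h
  · rfl
  · have h0 : chainSet μ ν (ν.card - μ.card) = ∅ :=
      Set.eq_empty_of_forall_notMem fun c hc => h (hc.1 ▸ hc.2.1 ▸ c.head_le_last)
    rw [h0, Set.ncard_empty]

theorem relDim_of_not_le {μ ν : YoungDiagram} (h : ¬ μ ≤ ν) : relDim μ ν = 0 := by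
  rw [relDim, if_neg h]

theorem eq_singleton_of_length_eq_zero {c : LTSeries YoungDiagram} (h : c.length = 0) :
    c = RelSeries.singleton _ c.head := by
  obtain ⟨n, f, hf⟩ := c
  simp only at h
  subst h
  refine RelSeries.ext rfl ?_
  ext1 i
  have : i = 0 := Subsingleton.elim (α := Fin 1) _ _
  subst this
  rfl

theorem chainSet_zero (μ : YoungDiagram) : chainSet μ μ 0 = {RelSeries.singleton _ μ} := by
  ext c
  simp only [chainSet, Set.mem_ofPred_eq, Set.mem_singleton_iff]
  constructor
  · rintro ⟨rfl, -, h⟩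
    exact eq_singleton_of_length_eq_zero h
  · rintro rfl
    simp

theorem relDim_self (μ : YoungDiagram) : relDim μ μ = 1 := by
  rw [relDim_eq_ncard, Nat.sub_self, chainSet_zero, Set.ncard_singleton]

/-- The erased element is known to be `ν`, so appending it recovers the chain. -/
theorem eraseLast_injOn (μ ν : YoungDiagram) (k : ℕ) :
    Set.InjOn RelSeries.eraseLast (chainSet μ ν (k + 1)) := by
  rintro c ⟨-, hc, hk⟩ c' ⟨-, hc', hk'⟩ h
  have e := congrArg RelSeries.toList (c.snoc_self_eraseLast (by omega))
  have e' := congrArg RelSeries.toList (c'.snoc_self_eraseLast (by omega))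
  rw [RelSeries.toList_snoc] at e e'
  refine RelSeries.toList_injective ?_
  rw [← e, ← e', h, hc, hc']

/-- The rows of a diagram whose last box can be removed. -/
def removableRows (ν : YoungDiagram) : Finset ℕ :=
  (Finset.range (ν.colLen 0)).filter fun i => ν.rowLen (i + 1) < ν.rowLen i

theorem mem_removableRows {ν : YoungDiagram} {i : ℕ} :
    i ∈ removableRows ν ↔ ν.rowLen (i + 1) < ν.rowLen i := by
  rw [removableRows, Finset.mem_filter, Finset.mem_range, and_iff_right_iff_imp]
  intro h
  by_contra hcon
  rw [rowLen_eq_zero (not_lt.1 hcon)] at h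
  omega

theorem card_removeBox {ν : YoungDiagram} {i : ℕ} (h : ν.rowLen (i + 1) < ν.rowLen i) :
    (removeBox ν i).card + 1 = ν.card := by
  have hi := mem_removableRows.2 h
  rw [removableRows, Finset.mem_filter] at hi
  have hs := sum_rowLen (le_refl (ν.colLen 0))
  have hs' := sum_rowLen (colLen_mono (removeBox_lt h).le)
  rw [Fin.sum_univ_eq_sum_range (fun k => ν.rowLen k)] at hs
  rw [Fin.sum_univ_eq_sum_range (fun k => (removeBox ν i).rowLen k)] at hs'
  rw [← Finset.add_sum_erase _ _ hi.1] at hs hs'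
  have : ∑ k ∈ (Finset.range (ν.colLen 0)).erase i, (removeBox ν i).rowLen k =
      ∑ k ∈ (Finset.range (ν.colLen 0)).erase i, ν.rowLen k := by
    refine Finset.sum_congr rfl fun k hk => ?_
    rw [rowLen_removeBox h, Function.update_of_ne (Finset.ne_of_mem_erase hk)]
  rw [this, rowLen_removeBox h, Function.update_self] at hs'
  omega

theorem image_eraseLast_chainSet {μ ν : YoungDiagram} {k : ℕ} (h : ν.card = μ.card + (k + 1)) :
    RelSeries.eraseLast '' chainSet μ ν (k + 1) =
      ⋃ i ∈ removableRows ν, chainSet μ (removeBox ν i) k := by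
  ext c
  simp only [Set.mem_image, Set.mem_iUnion, exists_prop, mem_removableRows]
  constructor
  · rintro ⟨c, ⟨h1, h2, h3⟩, rfl⟩
    have hlt : c.eraseLast.last < c.last := c.eraseLast_last_rel_last (by omega)
    have hlen : c.eraseLast.length = k := by
      rw [RelSeries.eraseLast_length, h3, Nat.add_sub_cancel]
    -- Each of the $k$ strict steps adds a box, so the penultimate diagram can be only one box
    -- smaller than `ν`.
    have hcard := card_add_length_le c.eraseLast
    rw [hlen, RelSeries.head_eraseLast, h1] at hcard
    rw [h2] at hlt
    obtain ⟨i, hi, e⟩ := exists_eq_removeBox hlt (by omega)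
    exact ⟨i, hi, h1, e, hlen⟩
  · rintro ⟨i, hi, h1, h2, h3⟩
    have hlt : c.last < ν := by rw [h2]; exact removeBox_lt hi
    refine ⟨c.snoc ν hlt, ⟨?_, ?_, ?_⟩, ?_⟩
    · rw [RelSeries.head_snoc, h1]
    · rw [RelSeries.last_snoc]
    · simp [h3]
    · refine RelSeries.toList_injective ?_
      rw [RelSeries.toList_eraseLast _ (by simp), RelSeries.toList_snoc,
        List.dropLast_concat]

theorem removeBox_injOn (ν : YoungDiagram) : Set.InjOn (removeBox ν) (removableRows ν) := by
  intro i hi j hj e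
  rw [Finset.mem_coe, mem_removableRows] at hi hj
  by_contra hne
  have h := rowLen_removeBox hi i
  rw [e, rowLen_removeBox hj, Function.update_self, Function.update_of_ne hne] at h
  omega

theorem chainSet_finite {μ : YoungDiagram} (k : ℕ) :
    ∀ ν : YoungDiagram, ν.card = μ.card + k → (chainSet μ ν k).Finite := by
  induction k with
  | zero =>
    intro ν _
    by_cases h : ν = μ
    · rw [h, chainSet_zero]; exact Set.finite_singleton _
    · convert Set.finite_empty
      refine Set.eq_empty_of_forall_notMem fun c hc => h ?_
      rw [← hc.1, ← hc.2.1, eq_singleton_of_length_eq_zero hc.2.2]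
      simp
  | succ k ih =>
    intro ν hν
    refine Set.Finite.of_finite_image ?_ (eraseLast_injOn μ ν k)
    rw [image_eraseLast_chainSet hν]
    refine Set.Finite.biUnion (Finset.finite_toSet _) fun i hi => ih _ ?_
    have := card_removeBox (mem_removableRows.1 hi)
    omega

/-- The branching rule: chains are sorted by their penultimate diagram. -/
theorem relDim_eq_sum {μ ν : YoungDiagram} (h : μ.card < ν.card) :
    relDim μ ν = ∑ i ∈ removableRows ν, relDim μ (removeBox ν i) := by
  obtain ⟨k, hk⟩ := Nat.exists_eq_add_of_lt h
  rw [relDim_eq_ncard, show ν.card - μ.card = k + 1 by omega,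
    ← (eraseLast_injOn μ ν k).ncard_image, image_eraseLast_chainSet (by omega)]
  have h1 := Set.Finite.ncard_biUnion (Finset.finite_toSet (removableRows ν))
    (s := fun i => chainSet μ (removeBox ν i) k) (fun i hi => chainSet_finite k _ (by
      have := card_removeBox (mem_removableRows.1 hi)
      omega)) (by
      intro i hi j hj hij
      refine Set.disjoint_left.2 fun c hc hc' => hij ?_
      exact removeBox_injOn ν hi hj (hc.2.1.symm.trans hc'.2.1))
  rw [finsum_mem_coe_finset] at h1
  refine h1.trans (Finset.sum_congr rfl fun i hi => ?_)
  have := card_removeBox (mem_removableRows.1 hi)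
  rw [relDim_eq_ncard, show (removeBox ν i).card - μ.card = k by omega]

/-! ### The determinant formula for the relative dimension -/

/-- The determinant of the falling factorials `l_i (l_i - 1) ⋯ (l_i - m_j + 1)`. -/
def fallingDet {N : ℕ} (l m : Fin N → ℕ) : ℂ :=
  (Matrix.of fun i j => ((l i).descFactorial (m j) : ℂ)).det

theorem mul_descFactorial_pred (l m : ℕ) :
    (l : ℂ) * ((l - 1).descFactorial m : ℂ) = ((l : ℂ) - m) * (l.descFactorial m : ℂ) := by
  rcases l with _ | l
  · rcases m with _ | m <;> simp
  · by_cases h : m ≤ l + 1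
    · have := congrArg (Nat.cast (R := ℂ)) (Nat.succ_descFactorial l m)
      push_cast [h] at this ⊢
      exact this.symm
    · rw [Nat.descFactorial_eq_zero_iff_lt.2 (by omega),
        Nat.descFactorial_eq_zero_iff_lt.2 (by omega)]
      simp

/-- In each term of the Leibniz expansion, $l(l-1)^{\downarrow m}=(l-m)\,l^{\downarrow m}$ applies
to the changed factor, and the sum of the numbers $l_{\sigma(k)}-m_k$ does not depend on $\sigma$.
The factor $l_i$ makes the truncated subtraction harmless at $l_i=0$. -/
theorem sum_mul_fallingDet_update {N : ℕ} (l m : Fin N → ℕ) :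
    ∑ i, (l i : ℂ) * fallingDet (Function.update l i (l i - 1)) m =
      (∑ i, (l i : ℂ) - ∑ i, (m i : ℂ)) * fallingDet l m := by
  have key : ∀ (σ : Equiv.Perm (Fin N)) (k : Fin N), (l (σ k) : ℂ) *
      ∏ j, ((Function.update l (σ k) (l (σ k) - 1) (σ j)).descFactorial (m j) : ℂ) =
      ((l (σ k) : ℂ) - m k) * ∏ j, ((l (σ j)).descFactorial (m j) : ℂ) := by
    intro σ k
    rw [← Finset.mul_prod_erase _ _ (Finset.mem_univ k),
      ← Finset.mul_prod_erase Finset.univ (fun j => ((l (σ j)).descFactorial (m j) : ℂ))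
        (Finset.mem_univ k), ← mul_assoc, ← mul_assoc, Function.update_self,
      mul_descFactorial_pred]
    congr 1
    refine Finset.prod_congr rfl fun j hj => ?_
    rw [Function.update_of_ne (σ.injective.ne (Finset.ne_of_mem_erase hj))]
  simp only [fallingDet, Matrix.det_apply, Matrix.of_apply, Finset.mul_sum]
  rw [Finset.sum_comm]
  refine Finset.sum_congr rfl fun σ _ => ?_
  simp only [mul_smul_comm, ← Finset.smul_sum]
  congr 1
  rw [← Equiv.sum_comp σ, Finset.sum_congr rfl fun k _ => key σ k, ← Finset.sum_mul,
    Finset.sum_sub_distrib, Equiv.sum_comp σ fun i => (l i : ℂ)]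

/-- The strictly decreasing numbers `ν_i + N - i`. -/
def shiftedRow (N : ℕ) (ν : YoungDiagram) (i : Fin N) : ℕ := ν.rowLen i + (N - 1 - i)

theorem shiftedRow_strictAnti (N : ℕ) (ν : YoungDiagram) : StrictAnti (shiftedRow N ν) := by
  intro i j h
  have h1 := ν.rowLen_anti i j h.le
  have h2 : (i : ℕ) < j := h
  simp only [shiftedRow]
  omega

/-- If $\mu_a>\nu_a$, all entries with row index at least $a$ and column index at most $a$ vanish,
and this block of zeros meets every permutation. -/
theorem fallingDet_eq_zero_of_not_le {N : ℕ} {μ ν : YoungDiagram} (hμ : μ.colLen 0 ≤ N)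
    (h : ¬ μ ≤ ν) : fallingDet (shiftedRow N ν) (shiftedRow N μ) = 0 := by
  rw [le_iff_rowLen_le] at h
  push Not at h
  obtain ⟨a, ha⟩ := h
  have haN : a < N := by
    by_contra hcon
    rw [rowLen_eq_zero (hμ.trans (not_lt.1 hcon))] at ha
    omega
  have hzero : ∀ i j : Fin N, a ≤ i → (j : ℕ) ≤ a →
      (shiftedRow N ν i).descFactorial (shiftedRow N μ j) = 0 := by
    intro i j hi hj
    rw [Nat.descFactorial_eq_zero_iff_lt]
    have h1 := ν.rowLen_anti a i hi
    have h2 := μ.rowLen_anti j a hj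
    simp only [shiftedRow]
    omega
  rw [fallingDet, Matrix.det_apply]
  refine Finset.sum_eq_zero fun σ _ => ?_
  -- Pigeonhole: otherwise `σ` would inject the $a+1$ columns up to $a$ into the $a$ rows before
  -- $a$.
  obtain ⟨j, hj, hσ⟩ : ∃ j : Fin N, (j : ℕ) ≤ a ∧ a ≤ (σ j : ℕ) := by
    by_contra hcon
    push Not at hcon
    have := Finset.card_le_card_of_injOn (s := Finset.Iic (⟨a, haN⟩ : Fin N))
      (t := Finset.Iio (⟨a, haN⟩ : Fin N)) σ (fun j hj => by
        simp only [Finset.coe_Iic, Set.mem_Iic, Fin.le_def] at hj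
        simp only [Finset.coe_Iio, Set.mem_Iio, Fin.lt_def]
        exact hcon j hj) σ.injective.injOn
    rw [Fin.card_Iic, Fin.card_Iio] at this
    simp only at this
    omega
  rw [Finset.prod_eq_zero (Finset.mem_univ j), smul_zero]
  rw [Matrix.of_apply, hzero _ _ hσ hj, Nat.cast_zero]

theorem fallingDet_self {N : ℕ} (ν : YoungDiagram) :
    fallingDet (shiftedRow N ν) (shiftedRow N ν) = ∏ i, ((shiftedRow N ν i).factorial : ℂ) := by
  rw [fallingDet, Matrix.det_of_isUpperTriangular]
  · simp [Nat.descFactorial_self]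
  · intro i j h
    have h' : j < i := h
    rw [Matrix.of_apply, Nat.descFactorial_eq_zero_iff_lt.2 (shiftedRow_strictAnti N ν h'),
      Nat.cast_zero]

theorem sum_shiftedRow {N : ℕ} {ν : YoungDiagram} (h : ν.colLen 0 ≤ N) :
    ∑ i, (shiftedRow N ν i : ℂ) = ν.card + ∑ i : Fin N, ((N - 1 - i : ℕ) : ℂ) := by
  rw [← sum_rowLen h]
  simp only [shiftedRow]
  push_cast
  rw [Finset.sum_add_distrib]

theorem shiftedRow_removeBox {N : ℕ} {ν : YoungDiagram} {i : Fin N}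
    (h : ν.rowLen (i + 1) < ν.rowLen i) : shiftedRow N (removeBox ν i) =
      Function.update (shiftedRow N ν) i (shiftedRow N ν i - 1) := by
  ext1 k
  simp only [shiftedRow, rowLen_removeBox h]
  by_cases hk : k = i
  · subst hk
    rw [Function.update_self, Function.update_self]
    omega
  · rw [Function.update_of_ne hk, Function.update_of_ne (fun e => hk (Fin.ext e)),
      shiftedRow]

/-- These terms of the sum over all rows have no counterpart in the branching rule. Lowering $l_i$
makes it equal to $l_{i+1}$, hence two rows agree; for the last row, $l_i$ itself is $0$. -/
theorem mul_fallingDet_update_eq_zero {N : ℕ} {ν : YoungDiagram} (hν : ν.colLen 0 ≤ N)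
    (m : Fin N → ℕ) {i : Fin N} (h : ¬ ν.rowLen (i + 1) < ν.rowLen i) :
    (shiftedRow N ν i : ℂ) *
      fallingDet (Function.update (shiftedRow N ν) i (shiftedRow N ν i - 1)) m = 0 := by
  have h1 := ν.rowLen_anti i (i + 1) (Nat.le_succ _)
  by_cases hi : (i : ℕ) + 1 < N
  · have h2 : fallingDet (Function.update (shiftedRow N ν) i (shiftedRow N ν i - 1)) m = 0 := by
      have hne : i ≠ ⟨i + 1, hi⟩ := fun e => by
        have := congrArg Fin.val e; simp at this
      refine Matrix.det_zero_of_row_eq hne ?_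
      ext1 j
      rw [Matrix.of_apply, Matrix.of_apply, Function.update_self, Function.update_of_ne hne.symm]
      congr 2
      simp only [shiftedRow]
      omega
    rw [h2, mul_zero]
  · have h2 : ν.rowLen (i + 1) = 0 := rowLen_eq_zero (by omega)
    have h3 : shiftedRow N ν i = 0 := by
      simp only [shiftedRow]
      omega
    rw [h3, Nat.cast_zero, zero_mul]

/-- Both sides satisfy the same recursion. The branching rule lowers one $l_i$, whose factorial
contributes the weight $l_i$ of `sum_mul_fallingDet_update`. The constant there is $|\nu|-|\mu|$,
which advances the factorial. -/
theorem relDim_mul_prod_factorial {N : ℕ} {μ : YoungDiagram} (hμ : μ.colLen 0 ≤ N) (k : ℕ) :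
    ∀ ν : YoungDiagram, ν.colLen 0 ≤ N → ν.card = μ.card + k →
      (relDim μ ν : ℂ) * ∏ i, ((shiftedRow N ν i).factorial : ℂ) =
        (k.factorial : ℂ) * fallingDet (shiftedRow N ν) (shiftedRow N μ) := by
  induction k with
  | zero =>
    intro ν hν hcard
    by_cases h : μ ≤ ν
    · have : μ = ν := by
        by_contra hne
        have := card_strictMono (lt_of_le_of_ne h hne)
        omega
      subst this
      rw [relDim_self, fallingDet_self]
      simp
    · rw [relDim_of_not_le h, fallingDet_eq_zero_of_not_le hμ h]
      simp
  | succ k ih =>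
    intro ν hν hcard
    have h1 := sum_mul_fallingDet_update (shiftedRow N ν) (shiftedRow N μ)
    rw [sum_shiftedRow hν, sum_shiftedRow hμ, hcard] at h1
    have h2 : ∀ i : Fin N, (k.factorial : ℂ) * ((shiftedRow N ν i : ℂ) *
        fallingDet (Function.update (shiftedRow N ν) i (shiftedRow N ν i - 1))
          (shiftedRow N μ)) =
        if ν.rowLen (i + 1) < ν.rowLen i then
          (relDim μ (removeBox ν i) : ℂ) * ∏ i, ((shiftedRow N ν i).factorial : ℂ) else 0 := by
      intro i
      split_ifs with h
      · have h3 := ih (removeBox ν i) ((colLen_mono (removeBox_lt h).le).trans hν) (by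
          have := card_removeBox h
          omega)
        rw [shiftedRow_removeBox h] at h3
        rw [mul_left_comm, ← h3, mul_left_comm]
        congr 1
        rw [← Finset.mul_prod_erase _ _ (Finset.mem_univ i),
          ← Finset.mul_prod_erase Finset.univ (fun j => ((shiftedRow N ν j).factorial : ℂ))
            (Finset.mem_univ i), ← mul_assoc, Function.update_self]
        congr 1
        · rw [← Nat.cast_mul, Nat.mul_factorial_pred]
          simp only [shiftedRow]
          omega
        · refine Finset.prod_congr rfl fun j hj => ?_
          rw [Function.update_of_ne (Finset.ne_of_mem_erase hj)]
      · rw [mul_fallingDet_update_eq_zero hν _ h, mul_zero]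
    have h4 : (relDim μ ν : ℂ) = ∑ i : Fin N,
        if ν.rowLen (i + 1) < ν.rowLen i then (relDim μ (removeBox ν i) : ℂ) else 0 := by
      rw [relDim_eq_sum (by omega), Nat.cast_sum, Fin.sum_univ_eq_sum_range
        (fun i => if ν.rowLen (i + 1) < ν.rowLen i then (relDim μ (removeBox ν i) : ℂ) else 0) N,
        ← Finset.sum_filter]
      refine Finset.sum_congr ?_ fun _ _ => rfl
      ext i
      rw [mem_removableRows, Finset.mem_filter, Finset.mem_range, iff_and_self]
      intro h
      by_contra hcon
      rw [rowLen_eq_zero (hν.trans (not_lt.1 hcon))] at h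
      omega
    rw [h4, Finset.sum_mul]
    simp only [ite_mul, zero_mul]
    rw [← Finset.sum_congr rfl fun i _ => h2 i, ← Finset.mul_sum, h1, Nat.factorial_succ]
    push_cast
    ring

/-! ### The values of the shifted Schur functions at diagrams -/

theorem eval_shiftedMatrix_det (μ ν : YoungDiagram) (N : ℕ) :
    eval (fun i : Fin N => (ν.rowLen i : ℂ)) (shiftedMatrix μ N).det =
      fallingDet (shiftedRow N ν) (shiftedRow N μ) := by
  rw [← aeval_eq_eval, AlgHom.map_det, fallingDet]
  congr 1
  ext1 i j
  rw [AlgHom.mapMatrix_apply, Matrix.map_apply, shiftedMatrix_apply, map_fallingPow,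
    Matrix.of_apply, ← fallingPow_natCast]
  congr 1
  have hi : (i : ℕ) ≤ N - 1 := by omega
  have hN : 1 ≤ N := by omega
  simp only [ell, shiftedRow, map_add, aeval_X, algHom_C]
  push_cast [hi, hN]
  simp

theorem fallingDet_bot_ne_zero (N : ℕ) (ν : YoungDiagram) :
    fallingDet (shiftedRow N ν) (shiftedRow N ⊥) ≠ 0 := by
  have h := det_fallingPow_rev (fun i => (shiftedRow N ν i : ℂ))
  have h1 : fallingDet (shiftedRow N ν) (shiftedRow N ⊥) =
      (Matrix.vandermonde ((fun i => (shiftedRow N ν i : ℂ)) ∘ Fin.rev)).det := by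
    rw [← h, fallingDet]
    congr 1
    ext1 i j
    rw [Matrix.of_apply, Matrix.of_apply, fallingPow_natCast]
    simp [shiftedRow]
  rw [h1, Matrix.det_vandermonde_ne_zero_iff]
  exact (Nat.cast_injective.comp (shiftedRow_strictAnti N ν).injective).comp Fin.rev_injective

theorem diagramEval_shiftedSchur_mul {N : ℕ} {μ ν : YoungDiagram} (hμ : μ.colLen 0 ≤ N)
    (hν : ν.colLen 0 ≤ N) :
    diagramEval ν (shiftedSchur μ) * fallingDet (shiftedRow N ν) (shiftedRow N ⊥) =
      fallingDet (shiftedRow N ν) (shiftedRow N μ) := by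
  rw [diagramEval_eq hν, ← eval_shiftedMatrix_det, ← eval_shiftedMatrix_det, ← map_mul,
    isShiftedSchur_shiftedSchur μ N hμ]

theorem diagramEval_shiftedSchur_of_not_le {μ ν : YoungDiagram} (h : ¬ μ ≤ ν) :
    diagramEval ν (shiftedSchur μ) = 0 := by
  have h1 := diagramEval_shiftedSchur_mul (le_max_left (μ.colLen 0) (ν.colLen 0))
    (le_max_right (μ.colLen 0) (ν.colLen 0))
  rw [fallingDet_eq_zero_of_not_le (le_max_left _ _) h] at h1
  exact (mul_eq_zero.1 h1).resolve_right (fallingDet_bot_ne_zero _ ν)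

/-- The determinant formulas for `μ` and `⊥` are divided: the product of the $l_i!$ cancels, and
$(n-m)!/n!$ is the inverse of the falling factorial. -/
theorem relDim_div_dim {μ ν : YoungDiagram} (h : μ.card ≤ ν.card) :
    (relDim μ ν : ℂ) / (dim ν : ℂ) =
      diagramEval ν (shiftedSchur μ) / (Nat.descFactorial ν.card μ.card : ℂ) := by
  obtain ⟨k, hk⟩ := Nat.exists_eq_add_of_le h
  have hμ : μ.colLen 0 ≤ max (μ.colLen 0) (ν.colLen 0) := le_max_left _ _
  have hν : ν.colLen 0 ≤ max (μ.colLen 0) (ν.colLen 0) := le_max_right _ _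
  have h1 := diagramEval_shiftedSchur_mul hμ hν
  have h2 := relDim_mul_prod_factorial hμ k ν hν hk
  have h3 := relDim_mul_prod_factorial (colLen_bot_le _) ν.card ν hν
    (by rw [show (⊥ : YoungDiagram).card = 0 from Finset.card_empty, zero_add])
  have h0 := fallingDet_bot_ne_zero (max (μ.colLen 0) (ν.colLen 0)) ν
  have hP : ∏ i, ((shiftedRow (max (μ.colLen 0) (ν.colLen 0)) ν i).factorial : ℂ) ≠ 0 :=
    Finset.prod_ne_zero_iff.2 fun i _ => Nat.cast_ne_zero.2 (Nat.factorial_ne_zero _)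
  have hn : (ν.card.factorial : ℂ) ≠ 0 := Nat.cast_ne_zero.2 (Nat.factorial_ne_zero _)
  have hd : (dim ν : ℂ) ≠ 0 := by
    intro e
    rw [← dim, e, zero_mul] at h3
    exact mul_ne_zero hn h0 h3.symm
  have hf : (Nat.descFactorial ν.card μ.card : ℂ) ≠ 0 :=
    Nat.cast_ne_zero.2 fun e => by
      rw [Nat.descFactorial_eq_zero_iff_lt] at e; omega
  have hfac : (k.factorial : ℂ) * (Nat.descFactorial ν.card μ.card : ℂ) = ν.card.factorial := by
    rw [← Nat.cast_mul, ← Nat.factorial_mul_descFactorial h, show ν.card - μ.card = k by omega]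
  rw [div_eq_div_iff hd hf]
  refine mul_right_cancel₀ (mul_ne_zero hP h0) ?_
  rw [← dim] at h3
  rw [← h1] at h2
  rw [← hfac] at h3
  linear_combination (Nat.descFactorial ν.card μ.card *
    fallingDet (shiftedRow (max (μ.colLen 0) (ν.colLen 0)) ν) (shiftedRow _ ⊥)) * h2 -
    diagramEval ν (shiftedSchur μ) *
    fallingDet (shiftedRow (max (μ.colLen 0) (ν.colLen 0)) ν) (shiftedRow _ ⊥) * h3

end FrobeniusSchur
end

open FrobeniusSchur
theorem theorem2p1 :
    -- the shifted Schur functions and the map used to define `Fs` are well defined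
    (∀ μ : YoungDiagram, ∃! s : ShiftedSym, IsShiftedSchur μ s) ∧
    (∃! φ : ShiftedSym →ₐ[ℂ] SuperSym, MapsHStar φ) ∧
    ∀ μ : YoungDiagram,
      -- the formula, for all `ν` such that the denominator does not vanish
      (∀ ν : YoungDiagram, μ.card ≤ ν.card →
        (relDim μ ν : ℂ) / (dim ν : ℂ) =
          evalFrobenius (Fs μ) ν / (Nat.descFactorial ν.card μ.card : ℂ)) ∧
      -- for the remaining `ν` the numerators vanish
      (∀ ν : YoungDiagram, ν.card < μ.card → relDim μ ν = 0 ∧ evalFrobenius (Fs μ) ν = 0) ∧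
      -- uniqueness
      (∀ F : SuperSym,
        (∀ ν : YoungDiagram, μ.card ≤ ν.card →
          (relDim μ ν : ℂ) / (dim ν : ℂ) =
            evalFrobenius F ν / (Nat.descFactorial ν.card μ.card : ℂ)) → F = Fs μ) := by
  have formula : ∀ μ ν : YoungDiagram, μ.card ≤ ν.card → (relDim μ ν : ℂ) / (dim ν : ℂ) =
      evalFrobenius (Fs μ) ν / (Nat.descFactorial ν.card μ.card : ℂ) := fun μ ν h => by
    rw [evalFrobenius_Fs, relDim_div_dim h]
  refine ⟨existsUnique_shiftedSchur, existsUnique_mapsHStar, fun μ =>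
    ⟨formula μ, fun ν hν => ?_, fun F hF => ?_⟩⟩
  · have hle : ¬ μ ≤ ν := fun h => absurd (card_strictMono.monotone h) (not_le.2 hν)
    exact ⟨relDim_of_not_le hle, by
      rw [evalFrobenius_Fs, diagramEval_shiftedSchur_of_not_le hle]⟩
  · refine superSym_ext (m := μ.card) fun ν hν => ?_
    have hf : (Nat.descFactorial ν.card μ.card : ℂ) ≠ 0 :=
      Nat.cast_ne_zero.2 fun e => by
        rw [Nat.descFactorial_eq_zero_iff_lt] at e; omega
    have := (hF ν hν).symm.trans (formula μ ν hν)
    rwa [div_left_inj' hf] at this
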